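/- Let $\epsilon\in\{-1,1\}$ and let $(M,g,J)$ be a connected $\epsilon$-Kähler manifold of dimension $\dim M\ge 4$: $g$ is a pseudo-Riemannian metric with Levi-Civita connection $\nabla$ and curvature tensor $R$, and $J$ is a smooth field of $g$-skew-symmetric endomorphisms of the tangent spaces with $J^2=\epsilon\,\mathrm{Id}$ and $\nabla J=0$. Let $S$ be a degenerate homogeneous $\epsilon$-Kähler structure of linear type on $(M,g,J)$, that is, a tensor field of type $(1,2)$ such that for $\tilde\nabla=\nabla-S$ $$\tilde\nabla g=0,\qquad \tilde\nabla R=0,\qquad \tilde\nabla S=0,\qquad \tilde\nabla J=0,$$ and $$S_XY=g(X,Y)\xi-g(\xi,Y)X+\epsilon g(X,JY)J\xi-\epsilon g(\xi,JY)JX-2g(\zeta,JX)JY$$ for some vector fields $\xi,\zeta$ with $g(\xi,\xi)=0$ and $\xi\neq0$ (not identically zero). Then $(M,g,J)$ is Ricci-flat. Moreover $\zeta=\lambda\xi$ for a constant $\lambda\in\mathbb R$, and if $\epsilon=-1$, or if $\epsilon=1$ and $J\xi\ne\pm\xi$ at some point (equivalently, $\xi$ and $J\xi$ are linearly independent at some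 point), then $\lambda=0$ or $\lambda=-\epsilon/2$. -/

import Mathlib

open Bundle Module
open scoped Manifold ContDiff

noncomputable section

section Manifold

variable (E : Type*) [NormedAddCommGroup E] [NormedSpace ℝ E]
  (M : Type*) [TopologicalSpace M] [ChartedSpace E M] [IsManifold 𝓘(ℝ, E) ∞ M]

/-- A smooth pseudo-Riemannian metric on a manifold modelled on `E`: a smooth field of symmetric
nondegenerate bilinear forms on the tangent spaces (of arbitrary signature). -/
structure PseudoRiemannianMetric where
  /-- The bilinear form on each tangent space. -/
  inner (x : M) :
    TangentSpace 𝓘(ℝ, E) x →L[ℝ] TangentSpace 𝓘(ℝ, E) x →L[ℝ] ℝ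
  symm (x : M) (v w : TangentSpace 𝓘(ℝ, E) x) : inner x v w = inner x w v
  nondegenerate (x : M) (v : TangentSpace 𝓘(ℝ, E) x) (hv : ∀ w, inner x v w = 0) : v = 0
  contMDiff : ContMDiff 𝓘(ℝ, E) (𝓘(ℝ, E).prod 𝓘(ℝ, E →L[ℝ] E →L[ℝ] ℝ)) ∞
    (fun x ↦ TotalSpace.mk' (E →L[ℝ] E →L[ℝ] ℝ)
      (E := fun x : M ↦ TangentSpace 𝓘(ℝ, E) x →L[ℝ] TangentSpace 𝓘(ℝ, E) x →L[ℝ] ℝ) x (inner x))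

/-- Linear connections on the tangent bundle. For a vector field `Y`, a point `x` and a
tangent vector `v` at `x`, the value of the derivative `∇_v Y` at `x` is `D Y x v`. -/
abbrev LinearConnection :=
  CovariantDerivative 𝓘(ℝ, E) E (fun x : M ↦ TangentSpace 𝓘(ℝ, E) x)

/-- Fields of endomorphisms of the tangent spaces. -/
abbrev EndField :=
  (x : M) → TangentSpace 𝓘(ℝ, E) x →L[ℝ] TangentSpace 𝓘(ℝ, E) x

/-- Tensor fields of type `(1, 2)`. On paper, `S x u v` is `S_u v`. -/
abbrev TensorField12 :=
  (x : M) → TangentSpace 𝓘(ℝ, E) x →L[ℝ] TangentSpace 𝓘(ℝ, E) x →L[ℝ] TangentSpace 𝓘(ℝ, E) x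

/-- Vector fields (not necessarily smooth). -/
abbrev VField := (x : M) → TangentSpace 𝓘(ℝ, E) x

end Manifold

variable {E : Type*} [NormedAddCommGroup E] [NormedSpace ℝ E]
  {M : Type*} [TopologicalSpace M] [ChartedSpace E M] [IsManifold 𝓘(ℝ, E) ∞ M]

/-- The vector field `Y` is smooth. -/
def SmoothVField (Y : VField E M) : Prop :=
  ContMDiff 𝓘(ℝ, E) (𝓘(ℝ, E).prod 𝓘(ℝ, E)) ∞
    (fun x ↦ TotalSpace.mk' E (E := fun x : M ↦ TangentSpace 𝓘(ℝ, E) x) x (Y x))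

/-- The vector field `Y` is differentiable at `x`. -/
def DiffVFieldAt (Y : VField E M) (x : M) : Prop :=
  MDifferentiableAt 𝓘(ℝ, E) (𝓘(ℝ, E).prod 𝓘(ℝ, E))
    (fun x ↦ TotalSpace.mk' E (E := fun x : M ↦ TangentSpace 𝓘(ℝ, E) x) x (Y x)) x

/-- The endomorphism field `J` is smooth. -/
def SmoothEndField (J : EndField E M) : Prop :=
  ContMDiff 𝓘(ℝ, E) (𝓘(ℝ, E).prod 𝓘(ℝ, E →L[ℝ] E)) ∞
    (fun x ↦ TotalSpace.mk' (E →L[ℝ] E)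
      (E := fun x : M ↦ TangentSpace 𝓘(ℝ, E) x →L[ℝ] TangentSpace 𝓘(ℝ, E) x) x (J x))

/-- The tensor field `S` of type `(1, 2)` is smooth. -/
def SmoothTensorField12 (S : TensorField12 E M) : Prop :=
  ContMDiff 𝓘(ℝ, E) (𝓘(ℝ, E).prod 𝓘(ℝ, E →L[ℝ] E →L[ℝ] E)) ∞
    (fun x ↦ TotalSpace.mk' (E →L[ℝ] E →L[ℝ] E)
      (E := fun x : M ↦ TangentSpace 𝓘(ℝ, E) x →L[ℝ]
        TangentSpace 𝓘(ℝ, E) x →L[ℝ] TangentSpace 𝓘(ℝ, E) x) x (S x))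

/-! ### Parallel tensor fields -/

/-- `D g = 0`: `v (g(Y, Z)) = g(D_v Y, Z) + g(Y, D_v Z)`. -/
def ParallelMetric (D : LinearConnection E M) (g : PseudoRiemannianMetric E M) : Prop :=
  ∀ (x : M) (Y Z : VField E M), DiffVFieldAt Y x → DiffVFieldAt Z x →
    ∀ v : TangentSpace 𝓘(ℝ, E) x,
      mfderiv 𝓘(ℝ, E) 𝓘(ℝ, ℝ) (fun y ↦ g.inner y (Y y) (Z y)) x v =
        g.inner x (D Y x v) (Z x) + g.inner x (Y x) (D Z x v)

/-- `D J = 0`: `D_v (J Y) = J (D_v Y)`. -/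
def ParallelEnd (D : LinearConnection E M) (J : EndField E M) : Prop :=
  ∀ (x : M) (Y : VField E M), DiffVFieldAt Y x → ∀ v : TangentSpace 𝓘(ℝ, E) x,
    D (fun y ↦ J y (Y y)) x v = J x (D Y x v)

/-- `D S = 0`: `D_v (S_Y Z) = S_{D_v Y} Z + S_Y (D_v Z)`. -/
def ParallelTensor12 (D : LinearConnection E M) (S : TensorField12 E M) : Prop :=
  ∀ (x : M) (Y Z : VField E M), DiffVFieldAt Y x → DiffVFieldAt Z x →
    ∀ v : TangentSpace 𝓘(ℝ, E) x,
      D (fun y ↦ S y (Y y) (Z y)) x v = S x (D Y x v) (Z x) + S x (Y x) (D Z x v)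

/-- `D R = 0` for a tensor field `R` of type `(1, 3)`:
`D_v (R(Y, Z) W) = R(D_v Y, Z) W + R(Y, D_v Z) W + R(Y, Z) (D_v W)`. -/
def ParallelTensor13 (D : LinearConnection E M)
    (R : (x : M) → TangentSpace 𝓘(ℝ, E) x → TangentSpace 𝓘(ℝ, E) x → TangentSpace 𝓘(ℝ, E) x →
      TangentSpace 𝓘(ℝ, E) x) : Prop :=
  ∀ (x : M) (Y Z W : VField E M), DiffVFieldAt Y x → DiffVFieldAt Z x → DiffVFieldAt W x →
    ∀ v : TangentSpace 𝓘(ℝ, E) x,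
      D (fun y ↦ R y (Y y) (Z y) (W y)) x v =
        R x (D Y x v) (Z x) (W x) + R x (Y x) (D Z x v) (W x) + R x (Y x) (Z x) (D W x v)

/-! ### The Levi-Civita connection, curvature and Ricci curvature -/

/-- `D` is the Levi-Civita connection of `g`: the (unique) smooth linear connection which is metric
and torsion-free. -/
structure IsLeviCivita [FiniteDimensional ℝ E] (g : PseudoRiemannianMetric E M)
    (D : LinearConnection E M) : Prop where
  smooth : D.ContMDiffCovariantDerivative ∞
  metric : ParallelMetric D g
  torsion_eq_zero : D.torsion = 0

/-- The curvature tensor `R(u, v) w = D_U D_V W - D_V D_U W - D_{[U, V]} W` at `x`, where `U`, `V`,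
`W` are vector fields that are smooth near `x` and have the values `u`, `v`, `w` at `x`. For a
smooth connection the choice of these fields is immaterial; we take those that are constant in the
preferred trivialization of the tangent bundle at `x`. -/
def curvature (D : LinearConnection E M) (x : M) (u v w : TangentSpace 𝓘(ℝ, E) x) :
    TangentSpace 𝓘(ℝ, E) x :=
  let U : VField E M := FiberBundle.extend E u
  let V : VField E M := FiberBundle.extend E v
  let W : VField E M := FiberBundle.extend E w
  D (fun y ↦ D W y (V y)) x u - D (fun y ↦ D W y (U y)) x v -
    D W x (VectorField.mlieBracket 𝓘(ℝ, E) U V x)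

/-- The Ricci tensor: `ricci D x v w` is the trace of the endomorphism `u ↦ R(u, v) w` of the
tangent space at `x`, computed in a basis. -/
def ricci [FiniteDimensional ℝ E] (D : LinearConnection E M) (x : M)
    (v w : TangentSpace 𝓘(ℝ, E) x) : ℝ :=
  let b : Basis (Fin (finrank ℝ E)) ℝ (TangentSpace 𝓘(ℝ, E) x) := finBasis ℝ E
  ∑ i, b.repr (curvature D x (b i) v w) i

/-! ### `ε`-Kähler structures and homogeneous structures of linear type -/

/-- `(M, g, J)` is `ε`-Kähler, where `D` is the Levi-Civita connection of `g`: `J` is a smooth field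
of `g`-skew-symmetric endomorphisms with `J ^ 2 = ε` which is parallel.
(`ε = -1`: pseudo-Kähler; `ε = 1`: para-Kähler.) -/
structure IsEpsKahler (ε : ℝ) (g : PseudoRiemannianMetric E M) (D : LinearConnection E M)
    (J : EndField E M) : Prop where
  smooth : SmoothEndField J
  skew : ∀ (x : M) (v w : TangentSpace 𝓘(ℝ, E) x), g.inner x (J x v) w = -g.inner x v (J x w)
  sq : ∀ (x : M) (v : TangentSpace 𝓘(ℝ, E) x), J x (J x v) = ε • v
  parallel : ParallelEnd D J

/-- The bilinear map `(v, u) ↦ -T(u, v)`. -/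
def negFlip (T : E →L[ℝ] E →L[ℝ] E) : E →L[ℝ] E →L[ℝ] E := -T.flip

/-- The linear connection `D - S`, that is, `(D - S)_v Y = D_v Y - S_v Y`. -/
def subTensor (D : LinearConnection E M) (S : TensorField12 E M) : LinearConnection E M :=
  D.addOneForm (fun x ↦ negFlip (E := E) (S x))

theorem subTensor_apply (D : LinearConnection E M) (S : TensorField12 E M) (Y : VField E M) (x : M)
    (v : TangentSpace 𝓘(ℝ, E) x) : subTensor D S Y x v = D Y x v - S x v (Y x) :=
  (sub_eq_add_neg (D Y x v) (S x v (Y x))).symm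

/-- `S` is a homogeneous `ε`-Kähler structure on the `ε`-Kähler manifold `(M, g, J)` with
Levi-Civita connection `D`: the tensors `g`, `R` (the curvature tensor of `g`), `S` and `J` are
parallel with respect to `D - S`. -/
structure IsHomogeneousStructure (g : PseudoRiemannianMetric E M) (D : LinearConnection E M)
    (J : EndField E M) (S : TensorField12 E M) : Prop where
  smooth : SmoothTensorField12 S
  metric : ParallelMetric (subTensor D S) g
  curvature : ParallelTensor13 (subTensor D S) (curvature D)
  tensor : ParallelTensor12 (subTensor D S) S
  endo : ParallelEnd (subTensor D S) J

/-- `S` is of linear type with associated smooth vector fields `ξ` and `ζ`: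
`S_u v = g(u,v) ξ - g(ξ,v) u + ε g(u,Jv) Jξ - ε g(ξ,Jv) Ju - 2 g(ζ,Ju) Jv`. -/
structure IsLinearType (ε : ℝ) (g : PseudoRiemannianMetric E M) (J : EndField E M)
    (S : TensorField12 E M) (ξ ζ : VField E M) : Prop where
  smooth_xi : SmoothVField ξ
  smooth_zeta : SmoothVField ζ
  eq : ∀ (x : M) (u v : TangentSpace 𝓘(ℝ, E) x),
    S x u v = g.inner x u v • ξ x - g.inner x (ξ x) v • u
      + (ε * g.inner x u (J x v)) • J x (ξ x) - (ε * g.inner x (ξ x) (J x v)) • J x u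
      - (2 * g.inner x (ζ x) (J x u)) • J x v

/-- Degeneracy: the vector field `ξ` is null and is not the zero vector field. -/
structure IsDegenerate (g : PseudoRiemannianMetric E M) (ξ : VField E M) : Prop where
  ne_zero : ξ ≠ 0
  null : ∀ x : M, g.inner x (ξ x) (ξ x) = 0

end

/-! Write `∇' = ∇ - S`. Differentiating the formula for `S` with `∇'`, which annihilates `S`, `g`
and `J`, leaves the same formula with `ξ`, `ζ` replaced by their `∇'`-derivatives. The map sending a
pair of vectors to a linear type tensor is injective in dimension at least 4
(`EpsHermitian.eq_zero_of_linType_eq_zero`), so `ξ` and `ζ` are `∇'`-parallel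
(`IsLinearType.parallel`).

The problem then becomes algebra at one point, recorded in `LinearTypeCurvature`. The curvature of
`∇'` is an explicit expression in `R`, `ξ`, `ζ`. It kills `ξ` and `ζ`, and it annihilates `R` as a
derivation. Moreover `∇R = S·R`, so the second Bianchi identity becomes an algebraic relation
between `S` and `R`.

Solving the first condition gives `R(X,Y)ξ` in the span of `ξ` and `Jξ` (`curv_xi_eq`). Two cases
remain. If `ξ` and `Jξ` are independent, the `J`-invariance of `R` forces `ζ` into their span, and
Bianchi then determines the coefficients (`of_independent`). If `Jξ = δξ` with `δ = ±1`, then `ζ =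
(k/2)ξ + m` with `Jm = -δm`; the first Bianchi identity gives `g(ξ,m) = 0`, and the derivation
condition gives `m = 0` (`eq_zero_of_eigenvector`). In both cases `R(·,·)ξ = 0`.

The second Bianchi identity now collapses to the vanishing of the cyclic sum of `g(ξ,X) R(Y,Z)`. Its
trace shows that the Ricci tensor is a multiple of the square of the 1-form `g(ξ,·)`, and its
behaviour under `J` makes that multiple zero (`trace_eq_zero_of_curv_xi`).

Passing to the connected manifold uses that a parallel field with one zero vanishes identically
(`eq_zero_of_parallel`). Hence `ξ` has no zeros, so the pointwise algebra applies everywhere, and `ζ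
- cξ` vanishes everywhere once it vanishes at one point. -/

noncomputable section

set_option linter.unusedSectionVars false

variable {E : Type*} [NormedAddCommGroup E] [NormedSpace ℝ E]
  {M : Type*} [TopologicalSpace M] [ChartedSpace E M] [IsManifold 𝓘(ℝ, E) ∞ M]

/-! ### Smooth vector fields -/

section SmoothFields

variable [FiniteDimensional ℝ E]

/-- Smooth real valued functions. -/
abbrev SmoothFun (f : M → ℝ) : Prop := ContMDiff 𝓘(ℝ, E) 𝓘(ℝ, ℝ) ∞ f

/-- The derivative `X f` of a function along a vector field. -/
def dirDeriv (X : VField E M) (f : M → ℝ) : M → ℝ := fun x ↦ mvfderiv 𝓘(ℝ, E) f x (X x)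

/-- The covariant derivative `D_X Y`. -/
def LinearConnection.along (D : LinearConnection E M) (X Y : VField E M) : VField E M :=
  fun x ↦ D Y x (X x)

theorem SmoothVField.diff {Y : VField E M} (hY : SmoothVField Y) (x : M) : DiffVFieldAt Y x :=
  (hY x).mdifferentiableAt (by simp)

theorem SmoothVField.add {X Y : VField E M} (hX : SmoothVField X) (hY : SmoothVField Y) :
    SmoothVField (X + Y) := ContMDiff.add_section hX hY

theorem SmoothVField.sub {X Y : VField E M} (hX : SmoothVField X) (hY : SmoothVField Y) :
    SmoothVField (X - Y) := ContMDiff.sub_section hX hY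

theorem SmoothVField.smul {f : M → ℝ} {Y : VField E M} (hf : SmoothFun (E := E) f)
    (hY : SmoothVField Y) : SmoothVField (f • Y) := ContMDiff.smul_section hf hY

theorem SmoothVField.const_smul {Y : VField E M} (c : ℝ) (hY : SmoothVField Y) :
    SmoothVField (c • Y) := ContMDiff.const_smul_section hY

theorem SmoothVField.endo {J : EndField E M} {Y : VField E M} (hJ : SmoothEndField J)
    (hY : SmoothVField Y) : SmoothVField (fun y ↦ J y (Y y)) :=
  ContMDiff.clm_bundle_apply hJ hY

theorem SmoothVField.tensor {S : TensorField12 E M} {X Y : VField E M}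
    (hS : SmoothTensorField12 S) (hX : SmoothVField X) (hY : SmoothVField Y) :
    SmoothVField (fun y ↦ S y (X y) (Y y)) :=
  ContMDiff.clm_bundle_apply (ContMDiff.clm_bundle_apply hS hX) hY

theorem PseudoRiemannianMetric.smooth_inner (g : PseudoRiemannianMetric E M) {X Y : VField E M}
    (hX : SmoothVField X) (hY : SmoothVField Y) :
    SmoothFun (E := E) (fun y ↦ g.inner y (X y) (Y y)) := by
  have := ContMDiff.clm_bundle_apply (E₂ := Trivial M ℝ)
    (ContMDiff.clm_bundle_apply g.contMDiff hX) hY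
  intro x
  exact ((contMDiffAt_section _).1 (this x))

theorem SmoothVField.along {D : LinearConnection E M} (hD : D.ContMDiffCovariantDerivative ∞)
    {X Y : VField E M} (hX : SmoothVField X) (hY : SmoothVField Y) :
    SmoothVField (D.along X Y) := by
  have h := hD.contMDiff.contMDiff (σ := Y) (by simpa using hY.contMDiffOn)
  rw [contMDiffOn_univ] at h
  exact ContMDiff.clm_bundle_apply h hX

theorem SmoothFun.diff {f : M → ℝ} (hf : SmoothFun (E := E) f) (x : M) :
    MDifferentiableAt 𝓘(ℝ, E) 𝓘(ℝ, ℝ) f x := (hf x).mdifferentiableAt (by simp)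

theorem isManifold_minSmoothness_two : IsManifold 𝓘(ℝ, E) (minSmoothness ℝ 2) M := by
  rw [minSmoothness_of_isRCLikeNormedField]
  infer_instance

theorem isManifold_minSmoothness_three : IsManifold 𝓘(ℝ, E) (minSmoothness ℝ 3) M := by
  rw [minSmoothness_of_isRCLikeNormedField]
  infer_instance

theorem SmoothVField.bracket {X Y : VField E M}
    (hX : SmoothVField X) (hY : SmoothVField Y) :
    SmoothVField (VectorField.mlieBracket 𝓘(ℝ, E) X Y) := by
  have := isManifold_minSmoothness_two (E := E) (M := M)
  have h1 : (∞ : WithTop ℕ∞) + 1 = ∞ := rfl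
  have : IsManifold 𝓘(ℝ, E) (∞ + 1) M := by rw [h1]; infer_instance
  exact ContDiff.mlieBracket_vectorField (n := ⊤) (m := ⊤) hX hY (by simp)

theorem SmoothFun.dirDeriv {X : VField E M} {f : M → ℝ} (hX : SmoothVField X)
    (hf : SmoothFun (E := E) f) : SmoothFun (E := E) (dirDeriv X f) := by
  have h1 : (∞ : WithTop ℕ∞) + 1 = ∞ := rfl
  have : IsManifold 𝓘(ℝ, E) (∞ + 1) M := by rw [h1]; infer_instance
  have h := (ContMDiff.contMDiff_tangentMap (m := ∞) hf (by simp)).comp hX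
  exact (contMDiff_snd_tangentBundle_modelSpace ℝ 𝓘(ℝ, ℝ)).comp h

theorem dirDeriv_add (X : VField E M) {f h : M → ℝ} (hf : SmoothFun (E := E) f)
    (hh : SmoothFun (E := E) h) : dirDeriv X (f + h) = dirDeriv X f + dirDeriv X h := by
  ext x
  simp [dirDeriv, mvfderiv_add (hf.diff x) (hh.diff x)]

theorem bracket_smul_right {X Y : VField E M} {f : M → ℝ} (hf : SmoothFun (E := E) f)
    (hY : SmoothVField Y) :
    VectorField.mlieBracket 𝓘(ℝ, E) X (f • Y) =
      dirDeriv X f • Y + f • VectorField.mlieBracket 𝓘(ℝ, E) X Y := by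
  ext1 x
  exact VectorField.mlieBracket_smul_right (hf.diff x) (hY.diff x)

theorem bracket_smul_left {X Y : VField E M} {f : M → ℝ} (hf : SmoothFun (E := E) f)
    (hX : SmoothVField X) :
    VectorField.mlieBracket 𝓘(ℝ, E) (f • X) Y =
      -(dirDeriv Y f • X) + f • VectorField.mlieBracket 𝓘(ℝ, E) X Y := by
  ext1 x
  simpa using! VectorField.mlieBracket_smul_left (W := Y) (hf.diff x) (hX.diff x)

theorem bracket_add_right {X Y Z : VField E M} (hY : SmoothVField Y) (hZ : SmoothVField Z) :
    VectorField.mlieBracket 𝓘(ℝ, E) X (Y + Z) =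
      VectorField.mlieBracket 𝓘(ℝ, E) X Y + VectorField.mlieBracket 𝓘(ℝ, E) X Z := by
  ext1 x
  exact VectorField.mlieBracket_add_right (hY.diff x) (hZ.diff x)

theorem bracket_add_left {X Y Z : VField E M} (hX : SmoothVField X) (hY : SmoothVField Y) :
    VectorField.mlieBracket 𝓘(ℝ, E) (X + Y) Z =
      VectorField.mlieBracket 𝓘(ℝ, E) X Z + VectorField.mlieBracket 𝓘(ℝ, E) Y Z := by
  ext1 x
  exact VectorField.mlieBracket_add_left (hX.diff x) (hY.diff x)

theorem bracket_jacobi {X Y Z : VField E M} (hX : SmoothVField X) (hY : SmoothVField Y)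
    (hZ : SmoothVField Z) :
    VectorField.mlieBracket 𝓘(ℝ, E) X (VectorField.mlieBracket 𝓘(ℝ, E) Y Z) =
      VectorField.mlieBracket 𝓘(ℝ, E) (VectorField.mlieBracket 𝓘(ℝ, E) X Y) Z +
        VectorField.mlieBracket 𝓘(ℝ, E) Y (VectorField.mlieBracket 𝓘(ℝ, E) X Z) := by
  have := isManifold_minSmoothness_three (E := E) (M := M)
  apply VectorField.leibniz_identity_mlieBracket
  · exact hX.of_le (by simpa using! (mod_cast le_top : ((2 : ℕ∞) : WithTop ℕ∞) ≤ ∞))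
  · exact hY.of_le (by simpa using! (mod_cast le_top : ((2 : ℕ∞) : WithTop ℕ∞) ≤ ∞))
  · exact hZ.of_le (by simpa using! (mod_cast le_top : ((2 : ℕ∞) : WithTop ℕ∞) ≤ ∞))

/-- The bracket acts on functions as the commutator of derivations. -/
theorem dirDeriv_bracket_smul {X Y Z : VField E M} {f : M → ℝ} (hX : SmoothVField X)
    (hY : SmoothVField Y) (hZ : SmoothVField Z) (hf : SmoothFun (E := E) f) :
    dirDeriv (VectorField.mlieBracket 𝓘(ℝ, E) X Y) f • Z =
      (dirDeriv X (dirDeriv Y f) - dirDeriv Y (dirDeriv X f)) • Z := by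
  -- Expand Jacobi for `X`, `Y`, `fZ` by the Leibniz rule: after removing `f` times Jacobi for `X`,
  -- `Y`, `Z`, only the coefficient of `Z` survives.
  have h := bracket_jacobi hX hY (hZ.smul hf)
  have hXf := SmoothFun.dirDeriv hX hf
  have hYf := SmoothFun.dirDeriv hY hf
  rw [bracket_smul_right hf hZ, bracket_smul_right hf hZ, bracket_smul_right hf hZ,
    bracket_add_right (hZ.smul hYf) ((hY.bracket hZ).smul hf),
    bracket_add_right (hZ.smul hXf) ((hX.bracket hZ).smul hf),
    bracket_smul_right hYf hZ, bracket_smul_right hXf hZ, bracket_smul_right hf (hY.bracket hZ),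
    bracket_smul_right hf (hX.bracket hZ), bracket_jacobi hX hY hZ] at h
  ext1 x
  have h' := congrFun h x
  simp only [Pi.add_apply, Pi.smul_apply', Pi.sub_apply, sub_smul, smul_add] at h' ⊢
  rw [eq_comm, ← sub_eq_zero]
  rw [← sub_eq_zero] at h'
  rw [← h']
  abel

end SmoothFields

/-! ### Global smooth extensions of local fields and functions -/

section Extension

variable [FiniteDimensional ℝ E] [T2Space M]

/-- A vector field which is smooth near a point agrees near this point with a global smooth one. -/
theorem exists_smoothVField_eventuallyEq {x : M} {u : Set M} (hu : IsOpen u) (hx : x ∈ u)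
    {Y : VField E M} (hY : ContMDiffOn 𝓘(ℝ, E) (𝓘(ℝ, E).prod 𝓘(ℝ, E)) ∞
      (fun x ↦ TotalSpace.mk' E (E := fun x : M ↦ TangentSpace 𝓘(ℝ, E) x) x (Y x)) u) :
    ∃ Z : VField E M, SmoothVField Z ∧ ∀ᶠ y in nhds x, Z y = Y y := by
  obtain ⟨f, hf⟩ := (SmoothBumpFunction.nhds_basis_tsupport (I := 𝓘(ℝ, E)) x).mem_iff.1
    (hu.mem_nhds hx)
  refine ⟨(f : M → ℝ) • Y, ContMDiffOn.smul_section_of_tsupport f.contMDiff.contMDiffOn hu hf.2 hY,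
    ?_⟩
  filter_upwards [f.eventuallyEq_one] with y hy
  simp [hy]

theorem exists_smoothFun_eventuallyEq {x : M} {u : Set M} (hu : IsOpen u) (hx : x ∈ u)
    {h : M → ℝ} (hh : ContMDiffOn 𝓘(ℝ, E) 𝓘(ℝ, ℝ) ∞ h u) :
    ∃ k : M → ℝ, SmoothFun (E := E) k ∧ ∀ᶠ y in nhds x, k y = h y := by
  obtain ⟨f, hf⟩ := (SmoothBumpFunction.nhds_basis_tsupport (I := 𝓘(ℝ, E)) x).mem_iff.1
    (hu.mem_nhds hx)
  refine ⟨fun y ↦ f y * h y, ?_, ?_⟩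
  · refine contMDiff_of_tsupport fun y hy ↦ ?_
    have hyu : y ∈ u := hf.2 (tsupport_mul_subset_left hy)
    exact f.contMDiff.contMDiffAt.mul ((hh y hyu).contMDiffAt (hu.mem_nhds hyu))
  · filter_upwards [f.eventuallyEq_one] with y hy
    simp [hy]

theorem contMDiffOn_extend {x : M} (v : TangentSpace 𝓘(ℝ, E) x) :
    ContMDiffOn 𝓘(ℝ, E) (𝓘(ℝ, E).prod 𝓘(ℝ, E)) ∞
      (fun y ↦ TotalSpace.mk' E (E := fun x : M ↦ TangentSpace 𝓘(ℝ, E) x) y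
        (FiberBundle.extend E v y)) (trivializationAt E (TangentSpace 𝓘(ℝ, E)) x).baseSet := by
  rw [Trivialization.contMDiffOn_section_baseSet_iff]
  refine (contMDiffOn_const (c := (trivializationAt E (TangentSpace 𝓘(ℝ, E)) x ⟨x, v⟩).2)).congr
    fun y hy ↦ ?_
  simp only [FiberBundle.extend]
  rw [Trivialization.apply_mk_symm _ hy]

theorem exists_smoothVField_extend {x : M} (v : TangentSpace 𝓘(ℝ, E) x) :
    ∃ Z : VField E M, SmoothVField Z ∧ ∀ᶠ y in nhds x, Z y = FiberBundle.extend E v y :=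
  exists_smoothVField_eventuallyEq (trivializationAt E (TangentSpace 𝓘(ℝ, E)) x).open_baseSet
    (FiberBundle.mem_baseSet_trivializationAt' x) (contMDiffOn_extend v)

/-- This is the passage between the two levels of the proof: tensor identities at a point are proved
by extending the vectors to global smooth fields. -/
theorem exists_smoothVField {x : M} (v : TangentSpace 𝓘(ℝ, E) x) :
    ∃ Z : VField E M, SmoothVField Z ∧ Z x = v := by
  obtain ⟨Z, hZ, h⟩ := exists_smoothVField_extend v
  exact ⟨Z, hZ, by simpa using h.self_of_nhds⟩

end Extension

/-! ### Tensoriality over smooth functions -/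

section Tensoriality

variable [FiniteDimensional ℝ E] [T2Space M]

/-- `Φ` is additive and linear over smooth functions, at the point `x`. -/
structure SmoothTensorialAt {A : Type*} [AddCommGroup A] [Module ℝ A] (Φ : VField E M → A)
    (x : M) : Prop where
  add : ∀ {Y Z : VField E M}, SmoothVField Y → SmoothVField Z → Φ (Y + Z) = Φ Y + Φ Z
  smul : ∀ {f : M → ℝ} {Y : VField E M}, SmoothFun (E := E) f → SmoothVField Y →
    Φ (f • Y) = f x • Φ Y

namespace SmoothTensorialAt

variable {A : Type*} [AddCommGroup A] [Module ℝ A] {Φ : VField E M → A} {x : M}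

/-- A bump function `f` supported where `Y = Z`, with `f x = 1`, satisfies `fY = fZ` globally, and
multiplying by `f` does not change the value of `Φ`. -/
theorem eq_of_eventuallyEq (h : SmoothTensorialAt Φ x) {Y Z : VField E M} (hY : SmoothVField Y)
    (hZ : SmoothVField Z) (hYZ : ∀ᶠ y in nhds x, Y y = Z y) : Φ Y = Φ Z := by
  obtain ⟨u, hu, huo, hxu⟩ := eventually_nhds_iff.1 hYZ
  obtain ⟨f, hf⟩ := (SmoothBumpFunction.nhds_basis_tsupport (I := 𝓘(ℝ, E)) x).mem_iff.1
    (huo.mem_nhds hxu)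
  have hfY : (f : M → ℝ) • Y = (f : M → ℝ) • Z := by
    ext1 y
    by_cases hy : f y = 0
    · simp [hy]
    · simp [hu y (hf.2 (subset_tsupport _ hy))]
  have h1 := h.smul (f := f) f.contMDiff hY
  have h2 := h.smul (f := f) f.contMDiff hZ
  rw [f.eq_one, one_smul] at h1 h2
  rw [← h1, ← h2, hfY]

theorem zero (h : SmoothTensorialAt Φ x) : Φ 0 = 0 := by
  have := h.smul (f := fun _ ↦ 0) (Y := 0) contMDiff_const (contMDiff_zeroSection _ _)
  simpa using this

theorem sum (h : SmoothTensorialAt Φ x) {ι : Type*} (s : Finset ι) (Y : ι → VField E M)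
    (hY : ∀ i ∈ s, SmoothVField (Y i)) :
    SmoothVField (∑ i ∈ s, Y i) ∧ Φ (∑ i ∈ s, Y i) = ∑ i ∈ s, Φ (Y i) := by
  classical
  induction s using Finset.induction_on with
  | empty => simpa using ⟨contMDiff_zeroSection _ _, h.zero⟩
  | insert a s ha ih =>
    obtain ⟨h1, h2⟩ := ih fun i hi ↦ hY i (Finset.mem_insert_of_mem hi)
    have ha' := hY a (Finset.mem_insert_self a s)
    rw [Finset.sum_insert ha, Finset.sum_insert ha]
    exact ⟨ha'.add h1, by rw [h.add ha' h1, h2]⟩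

/-- Near `x` the field is a combination of a local frame, with coefficients vanishing at `x`. Both
frame and coefficients are first cut off to global objects, because `Φ` is linear only over globally
smooth functions. -/
theorem eq_zero (h : SmoothTensorialAt Φ x) {Y : VField E M} (hY : SmoothVField Y)
    (hx : Y x = 0) : Φ Y = 0 := by
  let t := trivializationAt E (TangentSpace 𝓘(ℝ, E) : M → Type _) x
  have hxt : x ∈ t.baseSet := FiberBundle.mem_baseSet_trivializationAt' x
  let b := finBasis ℝ E
  have hs (i) := exists_smoothVField_eventuallyEq t.open_baseSet hxt
    (t.contMDiffOn_localFrame_baseSet (I := 𝓘(ℝ, E)) ∞ b i)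
  have hc (i) := exists_smoothFun_eventuallyEq t.open_baseSet hxt
    (contMDiffOn_baseSet_localFrameCoeff (e := t) b (k := ∞) (I := 𝓘(ℝ, E)) (s := Y)
      hY.contMDiffOn i)
  choose s hs hs' using hs
  choose c hc hc' using hc
  have hsum := h.sum Finset.univ (fun i ↦ c i • s i) fun i _ ↦ (hs i).smul (hc i)
  have key : ∀ᶠ y in nhds x, Y y = (∑ i, c i • s i) y := by
    filter_upwards [t.eventually_eq_localFrame_sum_coeff_smul (I := 𝓘(ℝ, E)) (s := Y) b hxt,
      Filter.eventually_all.2 hs', Filter.eventually_all.2 hc'] with y h1 h2 h3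
    rw [h1]
    simp [h2, h3]
  rw [h.eq_of_eventuallyEq hY hsum.1 key, hsum.2]
  refine Finset.sum_eq_zero fun i _ ↦ ?_
  rw [h.smul (hc i) (hs i), (hc' i).self_of_nhds]
  simp [hx]

theorem congr (h : SmoothTensorialAt Φ x) {Y Z : VField E M} (hY : SmoothVField Y)
    (hZ : SmoothVField Z) (hYZ : Y x = Z x) : Φ Y = Φ Z := by
  have h1 := h.add (hY.sub hZ) hZ
  rwa [sub_add_cancel, h.eq_zero (hY.sub hZ) (by simp [hYZ]), zero_add] at h1

end SmoothTensorialAt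

end Tensoriality

/-! ### The curvature operator -/

section Curvature

variable [FiniteDimensional ℝ E]

namespace LinearConnection

variable (D : LinearConnection E M)

theorem along_add_right (X : VField E M) {Y Z : VField E M} (hY : SmoothVField Y)
    (hZ : SmoothVField Z) : D.along X (Y + Z) = D.along X Y + D.along X Z := by
  ext1 x
  have := D.isCovariantDerivativeOnUniv.add (hY.diff x) (hZ.diff x)
  simp [along, this]

theorem along_smul_right (X : VField E M) {f : M → ℝ} {Y : VField E M}
    (hf : SmoothFun (E := E) f) (hY : SmoothVField Y) :
    D.along X (f • Y) = dirDeriv X f • Y + f • D.along X Y := by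
  ext1 x
  have := D.isCovariantDerivativeOnUniv.leibniz (hY.diff x) (hf.diff x)
  simp [along, this, dirDeriv, add_comm]

theorem along_neg_right (X : VField E M) {Y : VField E M} (hY : SmoothVField Y) :
    D.along X (-Y) = -D.along X Y := by
  ext1 x
  have := D.isCovariantDerivativeOnUniv.smul_const (-1) (hY.diff x)
  simp only [neg_smul, one_smul] at this
  simp [along, this]

theorem along_sub_right (X : VField E M) {Y Z : VField E M} (hY : SmoothVField Y)
    (hZ : SmoothVField Z) : D.along X (Y - Z) = D.along X Y - D.along X Z := by
  have hZ' : SmoothVField (-Z) := by simpa using! hZ.const_smul (-1)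
  rw [sub_eq_add_neg, D.along_add_right X hY hZ', D.along_neg_right X hZ, sub_eq_add_neg]

theorem along_add_left (X Y Z : VField E M) : D.along (X + Y) Z = D.along X Z + D.along Y Z := by
  ext1 x
  simp [along]

theorem along_neg_left (X Z : VField E M) : D.along (-X) Z = -D.along X Z := by
  ext1 x
  simp [along]

theorem along_smul_left (f : M → ℝ) (X Z : VField E M) : D.along (f • X) Z = f • D.along X Z := by
  ext1 x
  simp [along]

/-- The curvature `[D_X, D_Y] Z - D_[X, Y] Z` of vector fields. -/
def curvOp (X Y Z : VField E M) : VField E M :=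
  D.along X (D.along Y Z) - D.along Y (D.along X Z) -
    D.along (VectorField.mlieBracket 𝓘(ℝ, E) X Y) Z

theorem curvOp_swap (X Y Z : VField E M) : D.curvOp X Y Z = -D.curvOp Y X Z := by
  rw [curvOp, curvOp, VectorField.mlieBracket_swap, along_neg_left]
  abel

variable {D}

theorem curvOp_add_right (hD : D.ContMDiffCovariantDerivative ∞)
    {X Y Z W : VField E M} (hX : SmoothVField X) (hY : SmoothVField Y)
    (hZ : SmoothVField Z) (hW : SmoothVField W) :
    D.curvOp X Y (Z + W) = D.curvOp X Y Z + D.curvOp X Y W := by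
  simp only [curvOp]
  rw [D.along_add_right _ hZ hW, D.along_add_right _ hZ hW, D.along_add_right _ hZ hW,
    D.along_add_right _ (hY.along hD hZ) (hY.along hD hW),
    D.along_add_right _ (hX.along hD hZ) (hX.along hD hW)]
  abel

/-- The second derivatives of `f` occur only as the commutator `X(Yf) - Y(Xf)`, which the bracket
term absorbs; the products of first derivatives cancel by symmetry. -/
theorem curvOp_smul_right (hD : D.ContMDiffCovariantDerivative ∞)
    {X Y Z : VField E M} {f : M → ℝ} (hX : SmoothVField X)
    (hY : SmoothVField Y) (hZ : SmoothVField Z) (hf : SmoothFun (E := E) f) :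
    D.curvOp X Y (f • Z) = f • D.curvOp X Y Z := by
  have hXf := SmoothFun.dirDeriv hX hf
  have hYf := SmoothFun.dirDeriv hY hf
  simp only [curvOp]
  rw [D.along_smul_right _ hf hZ, D.along_smul_right _ hf hZ, D.along_smul_right _ hf hZ,
    D.along_add_right _ (hZ.smul hYf) ((hY.along hD hZ).smul hf),
    D.along_add_right _ (hZ.smul hXf) ((hX.along hD hZ).smul hf),
    D.along_smul_right _ hYf hZ, D.along_smul_right _ hXf hZ,
    D.along_smul_right _ hf (hY.along hD hZ), D.along_smul_right _ hf (hX.along hD hZ),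
    dirDeriv_bracket_smul hX hY hZ hf, smul_sub, smul_sub, sub_smul]
  abel

theorem curvOp_add_left (hD : D.ContMDiffCovariantDerivative ∞)
    {X X' Y Z : VField E M} (hX : SmoothVField X) (hX' : SmoothVField X')
    (hZ : SmoothVField Z) :
    D.curvOp (X + X') Y Z = D.curvOp X Y Z + D.curvOp X' Y Z := by
  simp only [curvOp]
  rw [along_add_left, along_add_left, D.along_add_right _ (hX.along hD hZ) (hX'.along hD hZ),
    bracket_add_left hX hX', along_add_left]
  abel

theorem curvOp_smul_left (hD : D.ContMDiffCovariantDerivative ∞)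
    {X Y Z : VField E M} {f : M → ℝ} (hX : SmoothVField X)
    (hZ : SmoothVField Z) (hf : SmoothFun (E := E) f) :
    D.curvOp (f • X) Y Z = f • D.curvOp X Y Z := by
  simp only [curvOp]
  rw [along_smul_left, along_smul_left, D.along_smul_right _ hf (hX.along hD hZ),
    bracket_smul_left hf hX, along_add_left, along_neg_left, along_smul_left, along_smul_left,
    smul_sub, smul_sub]
  abel

variable [T2Space M]

theorem curvOp_congr (hD : D.ContMDiffCovariantDerivative ∞)
    {X X' Y Y' Z Z' : VField E M} (hX : SmoothVField X) (hX' : SmoothVField X')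
    (hY : SmoothVField Y) (hY' : SmoothVField Y') (hZ : SmoothVField Z) (hZ' : SmoothVField Z')
    {x : M} (hXX' : X x = X' x) (hYY' : Y x = Y' x) (hZZ' : Z x = Z' x) :
    D.curvOp X Y Z x = D.curvOp X' Y' Z' x := by
  have h1 {Y Z : VField E M} (hY : SmoothVField Y) (hZ : SmoothVField Z) :
      SmoothTensorialAt (fun X ↦ D.curvOp X Y Z x) x :=
    ⟨fun hX hX' ↦ by rw [curvOp_add_left hD hX hX' hZ]; rfl,
      fun hf hX ↦ by rw [curvOp_smul_left hD hX hZ hf]; rfl⟩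
  have h3 : SmoothTensorialAt (fun Z ↦ D.curvOp X' Y' Z x) x :=
    ⟨fun hZ hZ' ↦ by rw [curvOp_add_right hD hX' hY' hZ hZ']; rfl,
      fun hf hZ ↦ by rw [curvOp_smul_right hD hX' hY' hZ hf]; rfl⟩
  rw [(h1 hY hZ).congr hX hX' hXX', curvOp_swap, Pi.neg_apply, (h1 hX' hZ).congr hY hY' hYY',
    ← Pi.neg_apply, ← curvOp_swap, h3.congr hZ hZ' hZZ']

/-- The fields used in `curvature` are smooth only near `x`. Global smooth fields agreeing with them
there give the same covariant derivatives by locality, and tensoriality then permits any smooth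
fields with the prescribed values. -/
theorem curvature_eq_curvOp (hD : D.ContMDiffCovariantDerivative ∞)
    {X Y Z : VField E M} (hX : SmoothVField X)
    (hY : SmoothVField Y) (hZ : SmoothVField Z) (x : M) :
    curvature D x (X x) (Y x) (Z x) = D.curvOp X Y Z x := by
  obtain ⟨U, hU, hUx⟩ := exists_smoothVField_extend (X x)
  obtain ⟨V, hV, hVx⟩ := exists_smoothVField_extend (Y x)
  obtain ⟨W, hW, hWx⟩ := exists_smoothVField_extend (Z x)
  rw [curvOp_congr hD hX hU hY hV hZ hW (by simpa using hUx.self_of_nhds.symm)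
    (by simpa using hVx.self_of_nhds.symm) (by simpa using hWx.self_of_nhds.symm)]
  have congr_diff {A B : VField E M} (hA : SmoothVField A) {y : M}
      (h : ∀ᶠ z in nhds y, A z = B z) : DiffVFieldAt B y :=
    (hA.diff y).congr_of_eventuallyEq (h.mono fun z hz ↦ by simp [hz])
  have congr_D {A B : VField E M} (hA : SmoothVField A) {y : M}
      (h : ∀ᶠ z in nhds y, A z = B z) : D B y = D A y :=
    D.isCovariantDerivativeOnUniv.congr_of_eventuallyEq (congr_diff hA h) (hA.diff y)
      Filter.univ_mem (h.mono fun z hz ↦ hz.symm)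
  have hDW {A B : VField E M} (h : ∀ᶠ z in nhds x, A z = B z) : ∀ᶠ y in nhds x,
      D.along A W y = D (FiberBundle.extend E (Z x)) y (B y) := by
    filter_upwards [hWx.eventually_nhds, h] with y h1 h2
    rw [congr_D hW h1, ← h2]
    rfl
  simp only [curvature, curvOp]
  rw [congr_D (hV.along hD hW) (hDW hVx), congr_D (hU.along hD hW) (hDW hUx), congr_D hW hWx,
    ← Filter.EventuallyEq.mlieBracket_vectorField_eq hUx hVx]
  have h1 := hUx.self_of_nhds
  have h2 := hVx.self_of_nhds
  simp only [FiberBundle.extend_apply_self] at h1 h2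
  simp [along, h1, h2]

end LinearConnection

end Curvature

/-! ### Symmetries of the curvature -/

section Symmetries

open VectorField

/-- The identity is already known after multiplication by a field `Z`; a `Z` that is nonzero at the
point can be cancelled, and it exists because `E` is nontrivial. -/
theorem dirDeriv_bracket [FiniteDimensional ℝ E] [T2Space M] [Nontrivial E] {X Y : VField E M}
    {f : M → ℝ} (hX : SmoothVField X) (hY : SmoothVField Y) (hf : SmoothFun (E := E) f) :
    dirDeriv (mlieBracket 𝓘(ℝ, E) X Y) f =
      dirDeriv X (dirDeriv Y f) - dirDeriv Y (dirDeriv X f) := by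
  ext x
  obtain ⟨v, hv⟩ := exists_ne (0 : E)
  obtain ⟨Z, hZ, hZx⟩ := exists_smoothVField (x := x) v
  have h := congrFun (dirDeriv_bracket_smul hX hY hZ hf) x
  simp only [Pi.smul_apply', hZx] at h
  exact smul_left_injective ℝ hv h

variable [FiniteDimensional ℝ E] {g : PseudoRiemannianMetric E M} {D : LinearConnection E M}

theorem IsLeviCivita.along_sub_along (hD : IsLeviCivita g D) {X Y : VField E M}
    (hX : SmoothVField X) (hY : SmoothVField Y) :
    D.along X Y - D.along Y X = mlieBracket 𝓘(ℝ, E) X Y := by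
  ext1 x
  exact D.torsion_eq_zero_iff.1 hD.torsion_eq_zero (hX.diff x) (hY.diff x)

theorem ParallelMetric.dirDeriv_inner {D : LinearConnection E M} (h : ParallelMetric D g)
    (X : VField E M) {Y Z : VField E M} (hY : SmoothVField Y) (hZ : SmoothVField Z) :
    dirDeriv X (fun y ↦ g.inner y (Y y) (Z y)) =
      (fun y ↦ g.inner y (D.along X Y y) (Z y)) + fun y ↦ g.inner y (Y y) (D.along X Z y) := by
  ext x
  exact h x Y Z (hY.diff x) (hZ.diff x) (X x)

theorem ParallelEnd.along_apply {J : EndField E M} (h : ParallelEnd D J) (X : VField E M)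
    {Y : VField E M} (hY : SmoothVField Y) :
    D.along X (fun y ↦ J y (Y y)) = fun y ↦ J y (D.along X Y y) := by
  ext1 x
  exact h x Y (hY.diff x) (X x)

theorem ParallelTensor12.along_apply {S : TensorField12 E M} (h : ParallelTensor12 D S)
    (X : VField E M) {Y Z : VField E M} (hY : SmoothVField Y) (hZ : SmoothVField Z) :
    D.along X (fun y ↦ S y (Y y) (Z y)) =
      (fun y ↦ S y (D.along X Y y) (Z y)) + fun y ↦ S y (Y y) (D.along X Z y) := by
  ext1 x
  exact h x Y Z (hY.diff x) (hZ.diff x) (X x)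

theorem subTensor_along (S : TensorField12 E M) (X Y : VField E M) :
    (subTensor D S).along X Y = D.along X Y - fun y ↦ S y (X y) (Y y) := by
  ext1 x
  exact subTensor_apply D S Y x (X x)

theorem SmoothVField.curvOp (hD : D.ContMDiffCovariantDerivative ∞) {X Y Z : VField E M}
    (hX : SmoothVField X) (hY : SmoothVField Y) (hZ : SmoothVField Z) :
    SmoothVField (D.curvOp X Y Z) :=
  ((hX.along hD (hY.along hD hZ)).sub (hY.along hD (hX.along hD hZ))).sub
    ((hX.bracket hY).along hD hZ)

theorem SmoothVField.subTensor_along (hD : D.ContMDiffCovariantDerivative ∞)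
    {S : TensorField12 E M} (hS : SmoothTensorField12 S) {X Y : VField E M}
    (hX : SmoothVField X) (hY : SmoothVField Y) : SmoothVField ((subTensor D S).along X Y) := by
  rw [_root_.subTensor_along]
  exact (hX.along hD hY).sub (SmoothVField.tensor hS hX hY)

theorem neg_bracket_left {X Y : VField E M} (hX : SmoothVField X) :
    mlieBracket 𝓘(ℝ, E) (-X) Y = -mlieBracket 𝓘(ℝ, E) X Y := by
  ext1 x
  have := mlieBracket_const_smul_left (W := Y) (c := -1) (hX.diff x)
  simpa using! this

/-- The algebraic (first) Bianchi identity for vector fields. -/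
theorem IsLeviCivita.curvOp_cyclic (hD : IsLeviCivita g D) {X Y Z : VField E M}
    (hX : SmoothVField X) (hY : SmoothVField Y) (hZ : SmoothVField Z) :
    D.curvOp X Y Z + D.curvOp Y Z X + D.curvOp Z X Y = 0 := by
  have hs := hD.smooth
  -- Vanishing torsion is used twice: for the pair `Y`, `Z`, and then for `X` and `[Y, Z]`. The
  -- cyclic sum reduces the identity to Jacobi.
  have key {X Y Z : VField E M} (hX : SmoothVField X) (hY : SmoothVField Y)
      (hZ : SmoothVField Z) : D.along X (D.along Y Z) - D.along X (D.along Z Y) =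
      mlieBracket 𝓘(ℝ, E) X (mlieBracket 𝓘(ℝ, E) Y Z) +
        D.along (mlieBracket 𝓘(ℝ, E) Y Z) X := by
    rw [← D.along_sub_right X (hY.along hs hZ) (hZ.along hs hY), hD.along_sub_along hY hZ,
      ← hD.along_sub_along hX (hY.bracket hZ)]
    abel
  have h1 := key hX hY hZ
  have h2 := key hY hZ hX
  have h3 := key hZ hX hY
  have hj := bracket_jacobi hX hY hZ
  rw [mlieBracket_swap (V := mlieBracket 𝓘(ℝ, E) X Y),
    mlieBracket_swap (V := X) (W := Z)] at hj
  have hn : mlieBracket 𝓘(ℝ, E) Y (-mlieBracket 𝓘(ℝ, E) Z X) =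
      -mlieBracket 𝓘(ℝ, E) Y (mlieBracket 𝓘(ℝ, E) Z X) := by
    rw [mlieBracket_swap, neg_bracket_left (hZ.bracket hX), ← mlieBracket_swap]
  rw [hn] at hj
  simp only [LinearConnection.curvOp]
  linear_combination (norm := module) h1 + h2 + h3 + hj

/-- The differential (second) Bianchi identity for vector fields. -/
theorem LinearConnection.curvOp_bianchi (hD : D.ContMDiffCovariantDerivative ∞)
    {X Y Z W : VField E M} (hX : SmoothVField X) (hY : SmoothVField Y) (hZ : SmoothVField Z)
    (hW : SmoothVField W) :
    (D.along X (D.curvOp Y Z W) - D.curvOp Y Z (D.along X W) -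
        D.curvOp (mlieBracket 𝓘(ℝ, E) X Y) Z W) +
      (D.along Y (D.curvOp Z X W) - D.curvOp Z X (D.along Y W) -
        D.curvOp (mlieBracket 𝓘(ℝ, E) Y Z) X W) +
      (D.along Z (D.curvOp X Y W) - D.curvOp X Y (D.along Z W) -
        D.curvOp (mlieBracket 𝓘(ℝ, E) Z X) Y W) = 0 := by
  have key {X Y Z : VField E M} (hX : SmoothVField X) (hY : SmoothVField Y)
      (hZ : SmoothVField Z) : D.along X (D.curvOp Y Z W) =
        D.along X (D.along Y (D.along Z W)) - D.along X (D.along Z (D.along Y W)) -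
          D.along X (D.along (mlieBracket 𝓘(ℝ, E) Y Z) W) := by
    rw [curvOp, D.along_sub_right X ((hY.along hD (hZ.along hD hW)).sub
      (hZ.along hD (hY.along hD hW))) ((hY.bracket hZ).along hD hW),
      D.along_sub_right X (hY.along hD (hZ.along hD hW)) (hZ.along hD (hY.along hD hW))]
  have hj := congrArg (fun A ↦ D.along A W) (bracket_jacobi hX hY hZ)
  rw [mlieBracket_swap (V := Y) (W := mlieBracket 𝓘(ℝ, E) X Z)] at hj
  have h1 : mlieBracket 𝓘(ℝ, E) (mlieBracket 𝓘(ℝ, E) X Z) Y =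
      -mlieBracket 𝓘(ℝ, E) (mlieBracket 𝓘(ℝ, E) Z X) Y := by
    rw [mlieBracket_swap (V := X), neg_bracket_left (hZ.bracket hX)]
  rw [mlieBracket_swap (V := X) (W := mlieBracket 𝓘(ℝ, E) Y Z), h1] at hj
  simp only [along_add_left, along_neg_left] at hj
  rw [key hX hY hZ, key hY hZ hX, key hZ hX hY]
  simp only [curvOp]
  linear_combination (norm := module) -hj

/-- Apply `[X, Y] = XY - YX` to the function `g(Z, W)`: the mixed terms pairing two first
derivatives are symmetric in `X`, `Y` and drop out. -/
theorem curvOp_metric_skew [T2Space M] [Nontrivial E] (hD : D.ContMDiffCovariantDerivative ∞)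
    (hg : ParallelMetric D g) {X Y Z W : VField E M} (hX : SmoothVField X) (hY : SmoothVField Y)
    (hZ : SmoothVField Z) (hW : SmoothVField W) (x : M) :
    g.inner x (D.curvOp X Y Z x) (W x) = -g.inner x (Z x) (D.curvOp X Y W x) := by
  have key {X Y : VField E M} (hX : SmoothVField X) (hY : SmoothVField Y) :
      dirDeriv X (dirDeriv Y fun y ↦ g.inner y (Z y) (W y)) x =
        g.inner x (D.along X (D.along Y Z) x) (W x) + g.inner x (D.along Y Z x) (D.along X W x) +
        (g.inner x (D.along X Z x) (D.along Y W x) +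
          g.inner x (Z x) (D.along X (D.along Y W) x)) := by
    rw [hg.dirDeriv_inner Y hZ hW,
      dirDeriv_add X (g.smooth_inner (hY.along hD hZ) hW) (g.smooth_inner hZ (hY.along hD hW)),
      hg.dirDeriv_inner X (hY.along hD hZ) hW, hg.dirDeriv_inner X hZ (hY.along hD hW)]
    rfl
  have h := congrFun (dirDeriv_bracket hX hY (g.smooth_inner hZ hW)) x
  rw [Pi.sub_apply, key hX hY, key hY hX, hg.dirDeriv_inner _ hZ hW] at h
  simp only [Pi.add_apply] at h
  simp only [LinearConnection.curvOp, Pi.sub_apply, map_sub, sub_apply]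
  linarith

theorem curvOp_endo (hD : D.ContMDiffCovariantDerivative ∞) {J : EndField E M}
    (hJ : ParallelEnd D J) {X Y Z : VField E M} (hX : SmoothVField X)
    (hY : SmoothVField Y) (hZ : SmoothVField Z) (x : M) :
    D.curvOp X Y (fun y ↦ J y (Z y)) x = J x (D.curvOp X Y Z x) := by
  simp only [LinearConnection.curvOp]
  rw [hJ.along_apply X hZ, hJ.along_apply Y hZ, hJ.along_apply _ hZ,
    hJ.along_apply _ (hX.along hD hZ), hJ.along_apply _ (hY.along hD hZ)]
  simp

end Symmetries

/-! ### Consequences of the Ambrose–Singer equations -/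

section AmbroseSinger

open VectorField LinearConnection

variable [FiniteDimensional ℝ E] {g : PseudoRiemannianMetric E M} {D : LinearConnection E M}
  {J : EndField E M} {S : TensorField12 E M}

/-- The curvature tensor of `D - S` in terms of the curvature of `D`, if `S` is parallel with
respect to `D - S`. -/
theorem curvOp_subTensor (hD : IsLeviCivita g D) (hS : SmoothTensorField12 S)
    (hp : ParallelTensor12 (subTensor D S) S) {X Y Z : VField E M} (hX : SmoothVField X)
    (hY : SmoothVField Y) (hZ : SmoothVField Z) (x : M) :
    (subTensor D S).curvOp X Y Z x = D.curvOp X Y Z x -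
      (S x (X x) (S x (Y x) (Z x)) - S x (Y x) (S x (X x) (Z x))) +
      S x (S x (X x) (Y x) - S x (Y x) (X x)) (Z x) := by
  have hs := hD.smooth
  have key {X Y : VField E M} (hX : SmoothVField X) (hY : SmoothVField Y) :
      (subTensor D S).along X ((subTensor D S).along Y Z) x =
        D.along X (D.along Y Z) x - S x (X x) (D.along Y Z x) -
          S x ((subTensor D S).along X Y x) (Z x) - S x (Y x) ((subTensor D S).along X Z x) := by
    rw [subTensor_along S Y Z, (subTensor D S).along_sub_right X (hY.along hs hZ)
      (SmoothVField.tensor hS hY hZ), hp.along_apply X hY hZ, subTensor_along S X (D.along Y Z)]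
    simp only [Pi.sub_apply, Pi.add_apply]
    abel
  have ht := congrFun (hD.along_sub_along hX hY) x
  simp only [Pi.sub_apply] at ht
  rw [curvOp, Pi.sub_apply, Pi.sub_apply, key hX hY, key hY hX]
  simp only [subTensor_along, curvOp, Pi.sub_apply, map_sub, sub_apply, ← ht]
  abel

theorem curvOp_eq_zero_of_parallel {D : LinearConnection E M} {Z : VField E M}
    (hZ : ∀ X : VField E M, D.along X Z = 0) (X Y : VField E M) : D.curvOp X Y Z = 0 := by
  have h0 (X : VField E M) : D.along X 0 = 0 := by
    ext1 x
    have : (D : _) 0 = 0 := D.zero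
    simp only [along]
    rw [this]
    rfl
  simp [curvOp, hZ, h0]

theorem ParallelTensor13.along_apply {D' : LinearConnection E M} [T2Space M]
    (hD : D.ContMDiffCovariantDerivative ∞)
    (h : ParallelTensor13 D' (curvature D)) (X : VField E M)
    {Y Z W : VField E M} (hY : SmoothVField Y) (hZ : SmoothVField Z) (hW : SmoothVField W)
    (hXY : SmoothVField (D'.along X Y)) (hXZ : SmoothVField (D'.along X Z))
    (hXW : SmoothVField (D'.along X W)) :
    D'.along X (D.curvOp Y Z W) = D.curvOp (D'.along X Y) Z W + D.curvOp Y (D'.along X Z) W +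
      D.curvOp Y Z (D'.along X W) := by
  have h1 : D.curvOp Y Z W = fun y ↦ curvature D y (Y y) (Z y) (W y) := by
    ext1 x
    rw [curvature_eq_curvOp hD hY hZ hW]
  ext1 x
  have := h x Y Z W (hY.diff x) (hZ.diff x) (hW.diff x) (X x)
  rw [Pi.add_apply, Pi.add_apply, ← curvature_eq_curvOp hD hXY hZ hW,
    ← curvature_eq_curvOp hD hY hXZ hW, ← curvature_eq_curvOp hD hY hZ hXW, h1]
  exact this

variable [T2Space M]

/-- The Ricci identity for the curvature tensor, parallel with respect to `D - S`. -/
theorem curvOp_subTensor_curvOp (hD : IsLeviCivita g D) (hS : SmoothTensorField12 S)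
    (hR : ParallelTensor13 (subTensor D S) (curvature D)) {X Y A B C : VField E M}
    (hX : SmoothVField X) (hY : SmoothVField Y) (hA : SmoothVField A) (hB : SmoothVField B)
    (hC : SmoothVField C) :
    (subTensor D S).curvOp X Y (D.curvOp A B C) =
      D.curvOp ((subTensor D S).curvOp X Y A) B C + D.curvOp A ((subTensor D S).curvOp X Y B) C +
        D.curvOp A B ((subTensor D S).curvOp X Y C) := by
  have hs := hD.smooth
  have sm {X Y : VField E M} (hX : SmoothVField X) (hY : SmoothVField Y) :
      SmoothVField ((subTensor D S).along X Y) := hX.subTensor_along hs hS hY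
  have smc {X Y Z : VField E M} (hX : SmoothVField X) (hY : SmoothVField Y)
      (hZ : SmoothVField Z) : SmoothVField (D.curvOp X Y Z) := hX.curvOp hs hY hZ
  have one {X A B C : VField E M} (hX : SmoothVField X) (hA : SmoothVField A)
      (hB : SmoothVField B) (hC : SmoothVField C) :=
    hR.along_apply hs X hA hB hC (sm hX hA) (sm hX hB) (sm hX hC)
  -- The second group of terms is symmetric in `X` and `Y`, hence disappears from the commutator;
  -- the first group gives the derivation action of the curvature.
  have two {X Y : VField E M} (hX : SmoothVField X) (hY : SmoothVField Y) :
      (subTensor D S).along X ((subTensor D S).along Y (D.curvOp A B C)) =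
      (D.curvOp ((subTensor D S).along X ((subTensor D S).along Y A)) B C +
        D.curvOp A ((subTensor D S).along X ((subTensor D S).along Y B)) C +
        D.curvOp A B ((subTensor D S).along X ((subTensor D S).along Y C))) +
      ((D.curvOp ((subTensor D S).along Y A) ((subTensor D S).along X B) C +
        D.curvOp ((subTensor D S).along X A) ((subTensor D S).along Y B) C) +
       (D.curvOp ((subTensor D S).along Y A) B ((subTensor D S).along X C) +
        D.curvOp ((subTensor D S).along X A) B ((subTensor D S).along Y C)) +
       (D.curvOp A ((subTensor D S).along Y B) ((subTensor D S).along X C) +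
        D.curvOp A ((subTensor D S).along X B) ((subTensor D S).along Y C))) := by
    rw [one hY hA hB hC, along_add_right _ X ((smc (sm hY hA) hB hC).add (smc hA (sm hY hB) hC))
      (smc hA hB (sm hY hC)), along_add_right _ X (smc (sm hY hA) hB hC) (smc hA (sm hY hB) hC),
      one hX (sm hY hA) hB hC, one hX hA (sm hY hB) hC, one hX hA hB (sm hY hC)]
    abel
  have sub1 {P Q : VField E M} (hP : SmoothVField P) (hQ : SmoothVField Q) :
      D.curvOp (P - Q) B C = D.curvOp P B C - D.curvOp Q B C := by
    have := curvOp_add_left (Y := B) hs (hP.sub hQ) hQ hC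
    rw [sub_add_cancel] at this
    rw [this, add_sub_cancel_right]
  have sub2 {P Q : VField E M} (hP : SmoothVField P) (hQ : SmoothVField Q) :
      D.curvOp A (P - Q) C = D.curvOp A P C - D.curvOp A Q C := by
    have := curvOp_add_left (Y := A) hs (hP.sub hQ) hQ hC
    rw [sub_add_cancel] at this
    rw [curvOp_swap, curvOp_swap D A P, curvOp_swap D A Q, this]
    abel
  have sub3 {P Q : VField E M} (hP : SmoothVField P) (hQ : SmoothVField Q) :
      D.curvOp A B (P - Q) = D.curvOp A B P - D.curvOp A B Q := by
    have := curvOp_add_right hs hA hB (hP.sub hQ) hQ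
    rw [sub_add_cancel] at this
    rw [this, add_sub_cancel_right]
  have hXY := hX.bracket hY
  have hdef (Z : VField E M) : (subTensor D S).curvOp X Y Z =
      (subTensor D S).along X ((subTensor D S).along Y Z) -
        (subTensor D S).along Y ((subTensor D S).along X Z) -
        (subTensor D S).along (mlieBracket 𝓘(ℝ, E) X Y) Z := rfl
  rw [hdef, hdef, hdef, hdef, two hX hY, two hY hX, one hXY hA hB hC,
    sub1 ((sm hX (sm hY hA)).sub (sm hY (sm hX hA))) (sm hXY hA),
    sub1 (sm hX (sm hY hA)) (sm hY (sm hX hA)),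
    sub2 ((sm hX (sm hY hB)).sub (sm hY (sm hX hB))) (sm hXY hB),
    sub2 (sm hX (sm hY hB)) (sm hY (sm hX hB)),
    sub3 ((sm hX (sm hY hC)).sub (sm hY (sm hX hC))) (sm hXY hC),
    sub3 (sm hX (sm hY hC)) (sm hY (sm hX hC))]
  abel

/-- The second Bianchi identity for a curvature tensor which is parallel with respect to
`D - S`. -/
theorem bianchi_of_parallel (hD : IsLeviCivita g D) (hS : SmoothTensorField12 S)
    (hR : ParallelTensor13 (subTensor D S) (curvature D)) (x : M)
    (u v w a : TangentSpace 𝓘(ℝ, E) x) :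
    (S x u (curvature D x v w a) - curvature D x (S x u v) w a - curvature D x v (S x u w) a -
        curvature D x v w (S x u a)) +
      (S x v (curvature D x w u a) - curvature D x (S x v w) u a - curvature D x w (S x v u) a -
        curvature D x w u (S x v a)) +
      (S x w (curvature D x u v a) - curvature D x (S x w u) v a - curvature D x u (S x w v) a -
        curvature D x u v (S x w a)) = 0 := by
  have hs := hD.smooth
  obtain ⟨X, hX, rfl⟩ := exists_smoothVField u
  obtain ⟨Y, hY, rfl⟩ := exists_smoothVField v
  obtain ⟨Z, hZ, rfl⟩ := exists_smoothVField w
  obtain ⟨A, hA, rfl⟩ := exists_smoothVField a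
  have sm {X Y : VField E M} (hX : SmoothVField X) (hY : SmoothVField Y) :=
    SmoothVField.tensor hS hX hY
  have sub1 {P Q : VField E M} (hP : SmoothVField P) (hQ : SmoothVField Q) {B : VField E M}
      (hB : SmoothVField B) :
      D.curvOp (P - Q) B A = D.curvOp P B A - D.curvOp Q B A := by
    have := curvOp_add_left (Y := B) hs (hP.sub hQ) hQ hA
    rw [sub_add_cancel] at this
    rw [this, add_sub_cancel_right]
  have sub2 {P Q B : VField E M} (hP : SmoothVField P) (hQ : SmoothVField Q)
      (hB : SmoothVField B) :
      D.curvOp B (P - Q) A = D.curvOp B P A - D.curvOp B Q A := by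
    rw [curvOp_swap, sub1 hP hQ hB, curvOp_swap D B P, curvOp_swap D B Q]
    abel
  have sub3 {P Q B C : VField E M} (hP : SmoothVField P) (hQ : SmoothVField Q)
      (hB : SmoothVField B) (hC : SmoothVField C) :
      D.curvOp B C (P - Q) = D.curvOp B C P - D.curvOp B C Q := by
    have := curvOp_add_right hs hB hC (hP.sub hQ) hQ
    rw [sub_add_cancel] at this
    rw [this, add_sub_cancel_right]
  -- Since `D - S` annihilates `R`, the derivation action of `S_X` on `R` equals `D_X R`. The last
  -- term is written with its arguments swapped so that the cyclic sum assembles the brackets `D_X Y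
  -- - D_Y X`.
  have key {X Y Z : VField E M} (hX : SmoothVField X) (hY : SmoothVField Y)
      (hZ : SmoothVField Z) :
      S x (X x) (curvature D x (Y x) (Z x) (A x)) - curvature D x (S x (X x) (Y x)) (Z x) (A x) -
          curvature D x (Y x) (S x (X x) (Z x)) (A x) -
          curvature D x (Y x) (Z x) (S x (X x) (A x)) =
        (D.along X (D.curvOp Y Z A) - D.curvOp Y Z (D.along X A) -
          (D.curvOp (D.along X Y) Z A - D.curvOp (D.along X Z) Y A)) x := by
    have h := hR.along_apply hs X hY hZ hA (hX.subTensor_along hs hS hY)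
      (hX.subTensor_along hs hS hZ) (hX.subTensor_along hs hS hA)
    simp only [subTensor_along] at h
    rw [sub1 (hX.along hs hY) (sm hX hY) hZ, sub2 (hX.along hs hZ) (sm hX hZ) hY,
      sub3 (hX.along hs hA) (sm hX hA) hY hZ] at h
    have h' := congrFun h x
    rw [curvOp_swap D (D.along X Z)]
    simp only [Pi.sub_apply, Pi.add_apply, Pi.neg_apply] at h' ⊢
    rw [curvature_eq_curvOp hs hY hZ hA, curvature_eq_curvOp hs (sm hX hY) hZ hA,
      curvature_eq_curvOp hs hY (sm hX hZ) hA, curvature_eq_curvOp hs hY hZ (sm hX hA)]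
    linear_combination (norm := module) -h'
  rw [key hX hY hZ, key hY hZ hX, key hZ hX hY]
  have hb := congrFun (curvOp_bianchi hs hX hY hZ hA) x
  rw [← hD.along_sub_along hX hY, ← hD.along_sub_along hY hZ, ← hD.along_sub_along hZ hX,
    sub1 (hX.along hs hY) (hY.along hs hX) hZ, sub1 (hY.along hs hZ) (hZ.along hs hY) hX,
    sub1 (hZ.along hs hX) (hX.along hs hZ) hY] at hb
  simp only [Pi.sub_apply, Pi.add_apply, Pi.zero_apply] at hb ⊢
  linear_combination (norm := module) hb

end AmbroseSinger

/-! ### `ε`-Hermitian linear algebra -/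

section LinearAlgebra

variable {V : Type*} [AddCommGroup V] [Module ℝ V]

/-- A nondegenerate symmetric bilinear form with a compatible skew-symmetric `J`, `J ^ 2 = ε`. -/
structure EpsHermitian (ε : ℝ) (g : V →ₗ[ℝ] V →ₗ[ℝ] ℝ) (J : V →ₗ[ℝ] V) : Prop where
  eps : ε = -1 ∨ ε = 1
  symm : ∀ v w, g v w = g w v
  nondeg : ∀ v, (∀ w, g v w = 0) → v = 0
  skew : ∀ v w, g (J v) w = -g v (J w)
  sq : ∀ v, J (J v) = ε • v

/-- The endomorphism `S_X` applied to `Y`, for the linear type structure given by `ξ` and `ζ`. -/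
def linType (ε : ℝ) (g : V →ₗ[ℝ] V →ₗ[ℝ] ℝ) (J : V →ₗ[ℝ] V) (ξ ζ X Y : V) : V :=
  g X Y • ξ - g ξ Y • X + (ε * g X (J Y)) • J ξ - (ε * g ξ (J Y)) • J X - (2 * g ζ (J X)) • J Y

namespace EpsHermitian

variable {ε : ℝ} {g : V →ₗ[ℝ] V →ₗ[ℝ] ℝ} {J : V →ₗ[ℝ] V}

theorem eps_sq (h : EpsHermitian ε g J) : ε * ε = 1 := by
  rcases h.eps with h | h <;> simp [h]

theorem ext (h : EpsHermitian ε g J) {v w : V} (hvw : ∀ u, g v u = g w u) : v = w :=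
  sub_eq_zero.1 <| h.nondeg _ fun u ↦ by simp [hvw u]

theorem map_self (h : EpsHermitian ε g J) (v : V) : g v (J v) = 0 := by
  have h1 := h.skew v v
  rw [h.symm] at h1
  linarith

/-- The metric identifies `V` with its dual and conjugates a skew endomorphism `A` into minus its
transpose, so the trace of `A` equals its own negative. -/
theorem trace_eq_zero [FiniteDimensional ℝ V] (h : EpsHermitian ε g J) {A : V →ₗ[ℝ] V}
    (hA : ∀ v w, g (A v) w = -g v (A w)) : LinearMap.trace ℝ V A = 0 := by
  have hinj : Function.Injective g := by
    rw [← LinearMap.ker_eq_bot, LinearMap.ker_eq_bot']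
    exact fun v hv ↦ h.nondeg v fun w ↦ by simp [hv]
  let G : V ≃ₗ[ℝ] Module.Dual ℝ V :=
    LinearEquiv.ofInjectiveOfFinrankEq g hinj (Subspace.dual_finrank_eq).symm
  have hG : G.conj A = -Module.Dual.transpose (R := ℝ) A := by
    ext φ w
    obtain ⟨v, rfl⟩ := G.surjective φ
    rw [LinearEquiv.conj_apply_apply, G.symm_apply_apply]
    exact hA v w
  have h1 := LinearMap.trace_conj' A G
  have h2 := (LinearMap.trace ℝ (Module.Dual ℝ V)).map_neg (Module.Dual.transpose (R := ℝ) A)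
  have h3 := LinearMap.trace_transpose' A
  rw [hG] at h1
  linarith

variable [FiniteDimensional ℝ V]

theorem trace_J (h : EpsHermitian ε g J) : LinearMap.trace ℝ V J = 0 := h.trace_eq_zero h.skew

/-- Two contractions suffice: the trace in the first argument, and the trace in the second argument
after composing with `J`. With `n` the dimension they form a linear system for `g(a, JY)` and `g(b,
JY)`, and eliminating `b` leaves the factor `n² - 4`, nonzero here. -/
theorem eq_zero_of_linType_eq_zero (h : EpsHermitian ε g J) (hV : 4 ≤ finrank ℝ V) {a b : V}
    (hab : ∀ X Y, linType ε g J a b X Y = 0) : a = 0 ∧ b = 0 := by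
  have hε := h.eps_sq
  have hN : (4 : ℝ) ≤ finrank ℝ V := by exact_mod_cast hV
  have h1 (Z : V) : (finrank ℝ V : ℝ) * g a Z + 2 * ε * g b Z = 0 := by
    have hT : (g.flip Z).smulRight a - (g a Z) • LinearMap.id +
        ε • (g.flip (J Z)).smulRight (J a) - (ε * g a (J Z)) • J -
        (2 : ℝ) • ((g b) ∘ₗ J).smulRight (J Z) = 0 := by
      ext Y
      have := hab Y Z
      simpa [linType, smul_smul] using this
    have := congrArg (LinearMap.trace ℝ V) hT
    simp only [map_sub, map_add, map_smul, LinearMap.trace_smulRight, LinearMap.trace_id,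
      h.trace_J, map_zero, LinearMap.flip_apply, LinearMap.comp_apply, h.skew, h.sq,
      smul_eq_mul] at this
    linear_combination -this - g a Z * hε
  have h2 (Y : V) : -4 * g a (J Y) - 2 * ε * finrank ℝ V * g b (J Y) = 0 := by
    have hT : (g Y).smulRight (J a) - (g a).smulRight (J Y) +
        (ε * ε) • ((g Y) ∘ₗ J).smulRight a - (ε * ε) • ((g a) ∘ₗ J).smulRight Y -
        (2 * ε * g b (J Y)) • LinearMap.id = 0 := by
      ext Z
      have := congrArg J (hab Y Z)
      simp only [linType, map_sub, map_add, map_smul, h.sq, map_zero] at this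
      simp only [LinearMap.sub_apply, LinearMap.add_apply, LinearMap.smul_apply,
        LinearMap.smulRight_apply, LinearMap.comp_apply, LinearMap.id_apply, LinearMap.zero_apply]
      linear_combination (norm := module) this
    have := congrArg (LinearMap.trace ℝ V) hT
    simp only [map_sub, map_add, map_smul, LinearMap.trace_smulRight, LinearMap.trace_id,
      map_zero, LinearMap.comp_apply, hε, smul_eq_mul] at this
    rw [h.symm Y (J a), h.skew] at this
    linear_combination this
  have h3 (Y : V) : g a (J Y) = 0 := by
    have e1 := h1 (J Y)
    have e2 := h2 Y
    have : ((finrank ℝ V : ℝ) ^ 2 - 4) * g a (J Y) = 0 := by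
      linear_combination e2 + finrank ℝ V * e1
    rcases mul_eq_zero.1 this with h | h
    · nlinarith
    · exact h
  have ha : a = 0 := h.nondeg a fun w ↦ by
    have := h3 (J w)
    rw [h.sq, map_smul, smul_eq_mul] at this
    linear_combination ε * this - g a w * hε
  refine ⟨ha, h.nondeg b fun w ↦ ?_⟩
  have := h1 w
  rw [ha, map_zero, LinearMap.zero_apply] at this
  linear_combination (ε / 2) * this - g b w * hε

end EpsHermitian

end LinearAlgebra

/-! ### Algebraic curvature tensors of linear type structures -/

section CurvatureAlgebra

variable {V : Type*} [AddCommGroup V] [Module ℝ V]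

section linType

variable (ε : ℝ) (g : V →ₗ[ℝ] V →ₗ[ℝ] ℝ) (J : V →ₗ[ℝ] V) (ξ ζ X Y Z : V) (a : ℝ)

theorem linType_add_right :
    linType ε g J ξ ζ X (Y + Z) = linType ε g J ξ ζ X Y + linType ε g J ξ ζ X Z := by
  simp only [linType, map_add]
  module

theorem linType_smul_right :
    linType ε g J ξ ζ X (a • Y) = a • linType ε g J ξ ζ X Y := by
  simp only [linType, map_smul, smul_eq_mul]
  module

theorem linType_sub_left :
    linType ε g J ξ ζ (X - Y) Z = linType ε g J ξ ζ X Z - linType ε g J ξ ζ Y Z := by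
  simp only [linType, map_sub, LinearMap.sub_apply]
  module

theorem linType_smul_left :
    linType ε g J ξ ζ (a • X) Y = a • linType ε g J ξ ζ X Y := by
  simp only [linType, map_smul, LinearMap.smul_apply, smul_eq_mul]
  module

theorem linType_J_right {ε : ℝ} {g : V →ₗ[ℝ] V →ₗ[ℝ] ℝ} {J : V →ₗ[ℝ] V}
    (h : EpsHermitian ε g J) (ξ ζ X Y : V) :
    linType ε g J ξ ζ X (J Y) = J (linType ε g J ξ ζ X Y) := by
  simp only [linType, map_add, map_sub, map_smul, h.sq, smul_eq_mul]
  rcases h.eps with rfl | rfl <;> module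

end linType

/-- An algebraic curvature tensor of `ε`-Kähler type. -/
structure EpsKahlerCurvature (ε : ℝ) (g : V →ₗ[ℝ] V →ₗ[ℝ] ℝ) (J : V →ₗ[ℝ] V)
    (R : V →ₗ[ℝ] V →ₗ[ℝ] V →ₗ[ℝ] V) : Prop extends EpsHermitian ε g J where
  swap : ∀ X Y Z, R X Y Z = -R Y X Z
  skewR : ∀ X Y Z W, g (R X Y Z) W = -g Z (R X Y W)
  endo : ∀ X Y Z, R X Y (J Z) = J (R X Y Z)
  cyclic : ∀ X Y Z, R X Y Z + R Y Z X + R Z X Y = 0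

/-- The curvature of `∇ - S` in terms of the curvature `R` of `∇`, for `S` of linear type. -/
def linCurv (ε : ℝ) (g : V →ₗ[ℝ] V →ₗ[ℝ] ℝ) (J : V →ₗ[ℝ] V)
    (R : V →ₗ[ℝ] V →ₗ[ℝ] V →ₗ[ℝ] V) (ξ ζ X Y Z : V) : V :=
  R X Y Z - (linType ε g J ξ ζ X (linType ε g J ξ ζ Y Z) -
      linType ε g J ξ ζ Y (linType ε g J ξ ζ X Z)) +
    linType ε g J ξ ζ (linType ε g J ξ ζ X Y - linType ε g J ξ ζ Y X) Z

/-- The pointwise algebraic data of a degenerate homogeneous `ε`-Kähler structure of linear type. -/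
structure LinearTypeCurvature (ε : ℝ) (g : V →ₗ[ℝ] V →ₗ[ℝ] ℝ) (J : V →ₗ[ℝ] V)
    (R : V →ₗ[ℝ] V →ₗ[ℝ] V →ₗ[ℝ] V) (ξ ζ : V) : Prop extends EpsKahlerCurvature ε g J R where
  ne_zero : ξ ≠ 0
  null : g ξ ξ = 0
  curv_xi : ∀ X Y, linCurv ε g J R ξ ζ X Y ξ = 0
  curv_zeta : ∀ X Y, linCurv ε g J R ξ ζ X Y ζ = 0
  curv_curv : ∀ X Y A B C, linCurv ε g J R ξ ζ X Y (R A B C) =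
    R (linCurv ε g J R ξ ζ X Y A) B C + R A (linCurv ε g J R ξ ζ X Y B) C +
      R A B (linCurv ε g J R ξ ζ X Y C)
  bianchi : ∀ X Y Z A,
    (linType ε g J ξ ζ X (R Y Z A) - R (linType ε g J ξ ζ X Y) Z A -
        R Y (linType ε g J ξ ζ X Z) A - R Y Z (linType ε g J ξ ζ X A)) +
      (linType ε g J ξ ζ Y (R Z X A) - R (linType ε g J ξ ζ Y Z) X A -
        R Z (linType ε g J ξ ζ Y X) A - R Z X (linType ε g J ξ ζ Y A)) +
      (linType ε g J ξ ζ Z (R X Y A) - R (linType ε g J ξ ζ Z X) Y A -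
        R X (linType ε g J ξ ζ Z Y) A - R X Y (linType ε g J ξ ζ Z A)) = 0

/-- This lets `S` be moved across the metric, so that the second Bianchi relation can be paired with
a test vector. -/
theorem EpsHermitian.linType_skew {ε : ℝ} {g : V →ₗ[ℝ] V →ₗ[ℝ] ℝ} {J : V →ₗ[ℝ] V}
    (h : EpsHermitian ε g J) (ξ ζ X Y Z : V) :
    g (linType ε g J ξ ζ X Y) Z = -g Y (linType ε g J ξ ζ X Z) := by
  simp only [linType, map_add, map_sub, map_smul, LinearMap.add_apply, LinearMap.sub_apply,
    LinearMap.smul_apply, smul_eq_mul, h.skew]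
  rw [h.symm Y ξ, h.symm Y X, h.symm Y (J ξ), h.symm Y (J X), h.skew, h.skew]
  ring

namespace EpsKahlerCurvature

variable {ε : ℝ} {g : V →ₗ[ℝ] V →ₗ[ℝ] ℝ} {J : V →ₗ[ℝ] V} {R : V →ₗ[ℝ] V →ₗ[ℝ] V →ₗ[ℝ] V}

theorem skew' (h : EpsKahlerCurvature ε g J R) (X Y Z W : V) :
    g (R X Y Z) W = -g (R X Y W) Z := by
  rw [h.skewR, h.symm]

theorem swap' (h : EpsKahlerCurvature ε g J R) (X Y Z W : V) :
    g (R X Y Z) W = -g (R Y X Z) W := by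
  rw [h.swap, map_neg, LinearMap.neg_apply]

theorem cyclic' (h : EpsKahlerCurvature ε g J R) (X Y Z W : V) :
    g (R X Y Z) W + g (R Y Z X) W + g (R Z X Y) W = 0 := by
  simpa using congrArg (fun v ↦ g v W) (h.cyclic X Y Z)

/-- The classical argument: the four cyclic identities on `X`, `Y`, `Z`, `W`, combined with the two
skew-symmetries. -/
theorem pair (h : EpsKahlerCurvature ε g J R) (X Y Z W : V) :
    g (R X Y Z) W = g (R Z W X) Y := by
  have h1 := h.cyclic' X Y Z W
  have h2 := h.cyclic' Y Z W X
  have h3 := h.cyclic' Z W X Y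
  have h4 := h.cyclic' W X Y Z
  have s1 := h.skew' Y Z X W
  have s2 := h.skew' Z X Y W
  have s3 := h.skew' X Y Z W
  have s4 := h.skew' Z W Y X
  have s5 := h.skew' W Y Z X
  have s6 := h.skew' W X Z Y
  have w1 := h.swap' Z X W Y
  have w2 := h.swap' Y W X Z
  have w3 := h.swap' Z X Y W
  have w4 := h.swap' W Y Z X
  have w5 := h.swap' W Y X Z
  linarith

/-- Pair symmetry carries the commutation of `R(X,Y)` with `J` over to the first two arguments. -/
theorem J_left (h : EpsKahlerCurvature ε g J R) (X Y Z : V) : R (J X) Y Z = -R X (J Y) Z := by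
  refine h.ext fun W ↦ ?_
  rw [h.pair, map_neg, LinearMap.neg_apply, h.pair X, h.endo, h.skew]

theorem J_J (h : EpsKahlerCurvature ε g J R) (X Y Z : V) :
    R (J X) (J Y) Z = -ε • R X Y Z := by
  rw [h.J_left, h.sq, map_smul, LinearMap.smul_apply, neg_smul]

end EpsKahlerCurvature

namespace LinearTypeCurvature

variable {ε : ℝ} {g : V →ₗ[ℝ] V →ₗ[ℝ] ℝ} {J : V →ₗ[ℝ] V} {R : V →ₗ[ℝ] V →ₗ[ℝ] V →ₗ[ℝ] V}
  {ξ ζ : V}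

set_option maxHeartbeats 1000000 in
-- The `ζ`-term of `S_X` is a multiple of `J`, which acts trivially on `R` as a derivation, so `ζ`
-- drops out. Among the `ξ`-terms, those proportional to `g(ξ, A)`, `g(ξ, U)` and their
-- `J`-analogues cancel by the first Bianchi identity.
theorem bianchi_reduced (h : LinearTypeCurvature ε g J R ξ ζ) (X Y Z A U : V) :
    2 * g ξ X * g (R Y Z A) U + 2 * g ξ Y * g (R Z X A) U + 2 * g ξ Z * g (R X Y A) U +
    (2 * ε * g X (J Y) * g (R (J ξ) Z A) U + 2 * ε * g Y (J Z) * g (R (J ξ) X A) U +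
      2 * ε * g Z (J X) * g (R (J ξ) Y A) U) +
    (g X A * g (R Y Z ξ) U + g Y A * g (R Z X ξ) U + g Z A * g (R X Y ξ) U) +
    ε * (g X (J A) * g (R Y Z (J ξ)) U + g Y (J A) * g (R Z X (J ξ)) U +
      g Z (J A) * g (R X Y (J ξ)) U) +
    (g X U * g (R Y Z A) ξ + g Y U * g (R Z X A) ξ + g Z U * g (R X Y A) ξ) +
    ε * (g X (J U) * g (R Y Z A) (J ξ) + g Y (J U) * g (R Z X A) (J ξ) +
      g Z (J U) * g (R X Y A) (J ξ)) = 0 := by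
  have h0 := congrArg (fun v ↦ g v U) (h.bianchi X Y Z A)
  simp only [map_add, map_sub, LinearMap.add_apply, LinearMap.sub_apply, h.linType_skew] at h0
  have r1 (P Q : V) := h.skew' P Q A
  have r2 (P Q S W : V) : g (R P Q (J S)) W = -g (R P Q S) (J W) := by rw [h.endo, h.skew]
  have j1 (P Q : V) : R P (J Q) = -R (J P) Q := by
    ext; simp [h.J_left]
  have sw (P Q : V) : R P Q = -R Q P := by
    ext; simp [h.swap P Q]
  have j2 (P Q : V) : R (J P) Q = R (J Q) P := by
    rw [sw, j1, neg_neg]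
  have c1 := h.cyclic' X Y Z U
  have c2 := h.cyclic' X Y Z (J U)
  have c3 := h.cyclic' X Y Z A
  have c4 := h.cyclic' X Y Z (J A)
  simp only [linType, map_add, map_sub, map_smul, LinearMap.add_apply, LinearMap.sub_apply,
    LinearMap.smul_apply, smul_eq_mul, map_zero, LinearMap.zero_apply] at h0
  simp only [j1 Y X, j1 Y Z, j1 Z Y, j1 Z X, j1 X Y, j1 X Z, j2 Y X, j2 Z Y, j2 X Z,
    sw X Z, sw Y X, sw Z Y, sw X ξ, sw Y ξ, sw Z ξ, sw X (J ξ), sw Y (J ξ), sw Z (J ξ),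
    LinearMap.neg_apply, map_neg, h.symm Y X, h.symm Z Y, h.symm X Z, r1 _ _ X, r1 _ _ Y,
    r1 _ _ Z, r1 _ _ (J X), r1 _ _ (J Y), r1 _ _ (J Z), r2 _ _ X, r2 _ _ Y, r2 _ _ Z,
    r2 _ _ A] at h0 ⊢
  have k (P Q : V) : g P (J Q) = -g Q (J P) := by rw [h.symm, h.skew]
  rw [k Y X, k Z Y, k X Z] at h0
  linear_combination -h0 + g ξ A * c1 - ε * g ξ (J A) * c2 - g ξ U * c3 + ε * g ξ (J U) * c4

/-- Because `ξ` is null, `S_P ξ` lies in the span of `ξ` and `Jξ`, which `S` preserves. Thus every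
term other than `R(X,Y)ξ` in the condition `curv_xi` is explicit. -/
theorem curv_xi_eq (h : LinearTypeCurvature ε g J R ξ ζ) (X Y : V) :
    R X Y ξ = (2 * (g ζ (J X) * g ξ (J Y) - g ζ (J Y) * g ξ (J X))) • ξ +
      (-4 * (g ζ (J X) * g ξ Y - g ζ (J Y) * g ξ X) -
        2 * (g ζ X * g ξ (J Y) - g ζ Y * g ξ (J X)) + 4 * g ξ ζ * g X (J Y) -
        4 * ε * (g ζ (J X) * g ζ Y - g ζ (J Y) * g ζ X)) • J ξ := by
  have h0 := h.curv_xi X Y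
  have k (P Q : V) : g P (J Q) = -g Q (J P) := by rw [h.symm, h.skew]
  have hS (P : V) : linType ε g J ξ ζ P ξ =
      g ξ P • ξ + (-ε * g ξ (J P) - 2 * g ζ (J P)) • J ξ := by
    rw [linType, h.null, h.map_self, k P, h.symm P]
    module
  simp only [linCurv, hS, linType_add_right, linType_smul_right,
    linType_J_right h.toEpsHermitian, map_add, map_smul, h.sq] at h0
  have hT1 : g ξ (linType ε g J ξ ζ X Y - linType ε g J ξ ζ Y X) =
      -2 * (g ζ (J X) * g ξ (J Y) - g ζ (J Y) * g ξ (J X)) := by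
    simp only [linType, map_add, map_sub, map_smul, smul_eq_mul, h.null, h.map_self]
    ring
  have hT2 : g ξ (J (linType ε g J ξ ζ X Y - linType ε g J ξ ζ Y X)) =
      -2 * ε * (g ζ (J X) * g ξ Y - g ζ (J Y) * g ξ X) := by
    simp only [linType, map_add, map_sub, map_smul, smul_eq_mul, h.null, h.map_self, h.sq]
    rcases h.eps with rfl | rfl <;> ring
  have hT3 : g ζ (J (linType ε g J ξ ζ X Y - linType ε g J ξ ζ Y X)) =
      -(g ξ Y * g ζ (J X) - g ξ X * g ζ (J Y)) + 2 * g X (J Y) * g ξ ζ -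
        (g ξ (J Y) * g ζ X - g ξ (J X) * g ζ Y) -
        2 * ε * (g ζ (J X) * g ζ Y - g ζ (J Y) * g ζ X) := by
    simp only [linType, map_add, map_sub, map_smul, smul_eq_mul, h.sq,
      h.symm ζ ξ, h.symm Y X, k Y X]
    rcases h.eps with rfl | rfl <;> ring
  rw [hT1, hT2, hT3] at h0
  rcases h.eps with rfl | rfl <;> linear_combination (norm := module) h0

end LinearTypeCurvature

end CurvatureAlgebra

/-! ### Solving the pointwise equations: `ξ` and `Jξ` independent, or `ξ` an eigenvector of `J` -/

section CurvatureCases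

variable {V : Type*} [AddCommGroup V] [Module ℝ V]
  {ε : ℝ} {g : V →ₗ[ℝ] V →ₗ[ℝ] ℝ} {J : V →ₗ[ℝ] V} {R : V →ₗ[ℝ] V →ₗ[ℝ] V →ₗ[ℝ] V} {ξ ζ : V}

theorem EpsHermitian.exists_eq_one (h : EpsHermitian ε g J) {v : V} (hv : v ≠ 0) :
    ∃ e, g v e = 1 := by
  by_contra! hne
  refine hv (h.nondeg v fun w ↦ ?_)
  by_contra hw
  exact hne ((g v w)⁻¹ • w) (by rw [map_smul, smul_eq_mul, inv_mul_cancel₀ hw])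

/-- Either `v` and `J v` are separated by a vector, or `v` is an eigenvector of `J`. -/
theorem EpsHermitian.dichotomy (h : EpsHermitian ε g J) {v : V} (hv : v ≠ 0) :
    (∃ e, g v e = 1 ∧ g (J v) e = 0) ∨ ε = 1 ∧ ∃ δ : ℝ, δ * δ = 1 ∧ J v = δ • v := by
  by_cases hex : ∃ e, g v e ≠ 0 ∧ g (J v) e = 0
  · obtain ⟨e, he, he'⟩ := hex
    refine Or.inl ⟨(g v e)⁻¹ • e, ?_, ?_⟩
    · rw [map_smul, smul_eq_mul, inv_mul_cancel₀ he]
    · rw [map_smul, he', smul_zero]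
  right
  push Not at hex
  have hJv : J v ≠ 0 := fun h0 ↦ hv <| by
    have := h.sq v
    rw [h0, map_zero] at this
    have h2 := congrArg (fun u ↦ ε • u) this
    simpa [smul_smul, h.eps_sq] using h2.symm
  obtain ⟨w, hw⟩ := h.exists_eq_one hJv
  -- Every vector annihilated by `g(Jv, ·)` is annihilated by `g(v, ·)`, so `v = c Jv`. Applying `J`
  -- yields `c²ε = 1`, which excludes `ε = -1`.
  have hc : v = g v w • J v := h.ext fun u ↦ by
    have := fun hne ↦ hex (u - g (J v) u • w) hne (by simp [hw])
    by_contra hne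
    refine this (fun h0 ↦ hne ?_)
    simp only [map_sub, map_smul, LinearMap.smul_apply, smul_eq_mul] at h0 ⊢
    linear_combination h0
  set c := g v w
  have h1 : J v = (c * ε) • v := by
    conv_lhs => rw [hc]
    rw [map_smul, h.sq, smul_smul]
  have h2 : (1 - c * (c * ε)) • v = 0 := by
    rw [sub_smul, one_smul, mul_smul, ← h1, ← hc, sub_self]
  have h3 : 1 - c * (c * ε) = 0 := (smul_eq_zero.1 h2).resolve_right hv
  have hε : ε = 1 := by
    rcases h.eps with rfl | rfl
    · nlinarith [sq_nonneg c]
    · rfl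
  exact ⟨hε, c * ε, by rw [hε] at h3 ⊢; linear_combination -h3, h1⟩

theorem EpsHermitian.apply_J_of_eigenvector (h : EpsHermitian ε g J) {v : V} {δ : ℝ}
    (hv : J v = δ • v) (w : V) : g v (J w) = -δ * g v w := by
  have := h.skew v w
  rw [hv, map_smul, LinearMap.smul_apply, smul_eq_mul] at this
  linarith

theorem EpsHermitian.null_of_eigenvector {v : V} {δ : ℝ} (h : EpsHermitian 1 g J) (hδ : δ * δ = 1)
    (hv : J v = δ • v) : g v v = 0 := by
  have h1 := h.skew v (J v)
  rw [h.sq, hv] at h1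
  simp only [map_smul, LinearMap.smul_apply, smul_eq_mul] at h1
  linear_combination h1 / 2 - (g v v / 2) * hδ

namespace LinearTypeCurvature

/-- If `ξ` and `J ξ` are independent, then `ζ` is a multiple of `ξ` and `R(·,·)ξ = 0`. -/
theorem of_independent (h : LinearTypeCurvature ε g J R ξ ζ) {e : V} (he : g ξ e = 1)
    (he' : g (J ξ) e = 0) :
    (∃ c : ℝ, ζ = c • ξ ∧ (c = 0 ∨ c = -ε / 2)) ∧ ∀ X Y, R X Y ξ = 0 := by
  have hε := h.eps_sq
  have he1 : g ξ (J e) = 0 := by rw [h.skew] at he'; linarith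
  -- Compare `R(JX, Je)ξ` with `-ε R(X, e)ξ` and pair with `e`: since `g(Jξ, e) = 0` only the
  -- `ξ`-coefficients remain, and they express `g(ζ, X)` through `g(ξ, X)` and `g(ξ, JX)`.
  have hζ : ζ = g ζ e • ξ + (-ε * g ζ (J e)) • J ξ := by
    refine h.ext fun X ↦ ?_
    have h1 := congrArg (fun v ↦ g v e) (h.J_J X e ξ)
    rw [h.curv_xi_eq, h.curv_xi_eq] at h1
    simp only [map_add, map_smul, LinearMap.add_apply, LinearMap.smul_apply, smul_eq_mul, h.sq,
      he, he', he1, h.skew] at h1 ⊢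
    rcases h.eps with rfl | rfl <;> linear_combination h1 / 2
  set l := g ζ e
  set μ := -ε * g ζ (J e)
  have k (P Q : V) : g P (J Q) = -g Q (J P) := by rw [h.symm, h.skew]
  have hR (X Y : V) : R X Y ξ = (g ξ Y * g ξ (J X) - g ξ X * g ξ (J Y)) •
      ((2 * ε * μ) • ξ + (-2 * l + 4 * μ ^ 2 - 4 * ε * l ^ 2) • J ξ) := by
    rw [h.curv_xi_eq, hζ]
    simp only [map_add, map_smul, LinearMap.add_apply, LinearMap.smul_apply, smul_eq_mul, h.sq,
      h.skew, h.null, h.map_self]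
    rcases h.eps with rfl | rfl <;> module
  set c := -2 * l + 4 * μ ^ 2 - 4 * ε * l ^ 2
  have hJR (X Y : V) : R X Y (J ξ) = (g ξ Y * g ξ (J X) - g ξ X * g ξ (J Y)) •
      ((2 * ε * μ) • J ξ + (ε * c) • ξ) := by
    rw [h.endo, hR]
    simp only [map_add, map_smul, h.sq]
    module
  have r1 (X Y : V) : g (R X Y e) ξ = - g (R X Y ξ) e := h.skew' _ _ _ _
  have r2 (X Y : V) : g (R X Y e) (J ξ) = - g (R X Y (J ξ)) e := h.skew' _ _ _ _
  have r3 (Y W : V) : g (R ξ Y e) W = g (R e W ξ) Y := h.pair _ _ _ _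
  have r4 (Y W : V) : g (R Y ξ e) W = -g (R e W ξ) Y := by rw [h.swap', h.pair]
  have r5 (Y W : V) : g (R (J ξ) Y e) W = g (R e W (J ξ)) Y := h.pair _ _ _ _
  have r6 (Y W : V) : g (R Y (J ξ) e) W = -g (R e W (J ξ)) Y := by rw [h.swap', h.pair]
  -- On these arguments every curvature term can be moved by pair symmetry to one containing
  -- `R(·,·)ξ` or `R(·,·)Jξ`, which are known. The first evaluation isolates `c`, the second `μ`.
  have b1 := h.bianchi_reduced e (J e) ξ e (J e)
  have b2 := h.bianchi_reduced e (J e) (J ξ) e (J e)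
  simp only [hR, hJR] at b1 b2
  simp only [r1, r2, r3, r4, r5, r6] at b1 b2
  simp only [hR, hJR, map_add, map_smul, LinearMap.add_apply, LinearMap.smul_apply,
    smul_eq_mul, h.sq, h.skew, h.null, h.map_self, h.symm e ξ, k e ξ, he, he1] at b1 b2
  have hc : c = 0 := by
    rcases h.eps with rfl | rfl <;> linear_combination b1 / 2
  have hμ : μ = 0 := by
    rcases h.eps with rfl | rfl
    · linear_combination b2 / 12
    · linear_combination -b2 / 12
  refine ⟨⟨l, by rw [hζ, hμ]; module, ?_⟩, fun X Y ↦ by rw [hR, hc, hμ]; module⟩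
  -- With `μ = 0`, the equation `c = 0` reads `-2l - 4εl² = 0`.
  have h0 : l * (l + ε / 2) = 0 := by
    linear_combination (-ε / 4) * hc + ε * μ * hμ - l ^ 2 * hε
  rcases mul_eq_zero.1 h0 with h1 | h1
  · exact Or.inl h1
  · exact Or.inr (by linear_combination h1)

/-- If `J ξ = δ • ξ`, then `ζ = (k / 2) • ξ + m` with `J m = -δ • m`. -/
theorem exists_decomposition_of_eigenvector (h : LinearTypeCurvature 1 g J R ξ ζ) {δ : ℝ}
    (hδ : δ * δ = 1) (hJ : J ξ = δ • ξ) :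
    ∃ (k : ℝ) (m : V), ζ = (k / 2) • ξ + m ∧ J m = -δ • m := by
  obtain ⟨e, he⟩ := h.exists_eq_one h.ne_zero
  have hθ := h.apply_J_of_eigenvector hJ
  refine ⟨g ζ e - δ * g ζ (J e), ζ - ((g ζ e - δ * g ζ (J e)) / 2) • ξ, by module, ?_⟩
  -- The left side is twice the `δ`-eigencomponent of `ζ`. The `J`-invariance of `R`, paired with
  -- `e`, shows that it is proportional to `ξ`.
  have key : ζ + δ • J ζ = (g ζ e - δ * g ζ (J e)) • ξ := by
    refine h.ext fun X ↦ ?_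
    have h1 := congrArg (fun v ↦ g v e) (h.J_J X e ξ)
    rw [h.curv_xi_eq, h.curv_xi_eq] at h1
    simp only [map_add, map_smul, LinearMap.add_apply, LinearMap.smul_apply, smul_eq_mul, h.sq,
      he, hJ, hθ, h.skew] at h1 ⊢
    linear_combination h1 / 8 - (3 / 4) * (g ζ X - g ξ X * g ζ e) * hδ
  have key2 := congrArg (fun v ↦ δ • v) key
  simp only [smul_add, smul_smul, hδ, one_smul] at key2
  rw [map_sub, map_smul, hJ]
  linear_combination (norm := module) key2

/-! ### The case `Jξ = δξ`, with `ζ = (k/2)ξ + m` and `Jm = -δm` -/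

section Eigenvector

variable {m : V} {δ k : ℝ}

theorem curv_xi_of_eigenvector (h : LinearTypeCurvature 1 g J R ξ ((k / 2) • ξ + m))
    (hδ : δ * δ = 1) (hJ : J ξ = δ • ξ) (hm : J m = -δ • m) (X Y : V) :
    R X Y ξ = (-4 * (1 + k) * (g m X * g ξ Y - g m Y * g ξ X) + 4 * δ * g ξ m * g X (J Y)) • ξ := by
  have hθ := h.apply_J_of_eigenvector hJ
  have hM := h.apply_J_of_eigenvector hm
  rw [h.curv_xi_eq]
  simp only [map_add, map_smul, LinearMap.add_apply, LinearMap.smul_apply, smul_eq_mul, hθ, hM,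
    neg_neg, hJ, h.null, smul_smul]
  rw [← add_smul]
  congr 1
  linear_combination (4 * (g ξ X * g m Y - g m X * g ξ Y) * (1 + k)) * hδ

/-- If `g(ξ, m)` were nonzero, the first Bianchi identity would write the identity map as a sum of
two rank-one maps, each of trace 1, which is impossible in dimension at least 4. -/
theorem inner_eq_zero_of_eigenvector [FiniteDimensional ℝ V] (hV : 4 ≤ finrank ℝ V)
    (h : LinearTypeCurvature 1 g J R ξ ((k / 2) • ξ + m))
    (hδ : δ * δ = 1) (hJ : J ξ = δ • ξ) (hm : J m = -δ • m) : g ξ m = 0 := by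
  have hδ0 : δ ≠ 0 := fun h0 ↦ by simp [h0] at hδ
  obtain ⟨e, he⟩ := h.exists_eq_one h.ne_zero
  have hθ := h.apply_J_of_eigenvector hJ
  have h1 (Y W : V) : g ξ m * (g e (J Y) * g ξ W - g e (J W) * g ξ Y + g Y (J W)) = 0 := by
    have h1 := h.cyclic' e Y ξ W
    rw [h.swap' Y, h.pair ξ, h.pair ξ] at h1
    simp only [h.curv_xi_of_eigenvector hδ hJ hm, map_smul, LinearMap.smul_apply, smul_eq_mul,
      he] at h1
    linear_combination (δ / 4) * h1 - (g ξ m * (g e (J Y) * g ξ W - g e (J W) * g ξ Y +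
      g Y (J W))) * hδ
  have h2 : g ξ m • (δ • (g e ∘ₗ J).smulRight ξ + (g ξ).smulRight e - LinearMap.id) =
      (0 : V →ₗ[ℝ] V) := by
    ext Y
    have h2 : g ξ m • (g e (J Y) • ξ + g ξ Y • J e - J Y) = 0 := h.nondeg _ fun W ↦ by
      simp only [map_add, map_sub, map_smul, LinearMap.add_apply, LinearMap.sub_apply,
        LinearMap.smul_apply, smul_eq_mul, h.skew]
      linear_combination h1 Y W
    have h3 := congrArg J h2
    simp only [map_smul, map_add, map_sub, h.sq, hJ, map_zero, one_smul] at h3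
    simp only [LinearMap.smul_apply, LinearMap.add_apply, LinearMap.sub_apply,
      LinearMap.smulRight_apply, LinearMap.comp_apply, LinearMap.id_apply, LinearMap.zero_apply]
    linear_combination (norm := module) h3
  have h3 := congrArg (LinearMap.trace ℝ V) h2
  simp only [map_sub, map_add, map_smul, LinearMap.trace_smulRight, LinearMap.trace_id,
    map_zero, LinearMap.comp_apply, smul_eq_mul, hJ, h.symm e ξ, he] at h3
  have hN : (4 : ℝ) ≤ finrank ℝ V := by exact_mod_cast hV
  have h4 : g ξ m * (2 - finrank ℝ V) = 0 := by linear_combination h3 - g ξ m * hδ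
  exact (mul_eq_zero.1 h4).resolve_right (by linarith)

/-- The curvature of the modified connection kills `ξ` and `ζ`, hence kills `m`. Once `g(ξ, m) = 0`,
each `S_P` multiplies `m` by a scalar, so the commutator `[S_X, S_Y]` contributes nothing and only
the torsion term remains. -/
theorem curv_of_eigenvector (h : LinearTypeCurvature 1 g J R ξ ((k / 2) • ξ + m))
    (hδ : δ * δ = 1) (hJ : J ξ = δ • ξ) (hm : J m = -δ • m) (hp : g ξ m = 0) (X Y : V) :
    R X Y m = (4 * k * (g m X * g ξ Y - g m Y * g ξ X)) • m := by
  have hθ := h.apply_J_of_eigenvector hJ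
  have hM := h.apply_J_of_eigenvector hm
  have hmm := h.null_of_eigenvector (δ := -δ) (by linear_combination hδ) hm
  have h0 := h.curv_zeta X Y
  have hS (P : V) : linType 1 g J ξ ((k / 2) • ξ + m) P m = (2 * g m P - k * g ξ P) • m := by
    simp only [linType, map_add, map_smul, LinearMap.add_apply, LinearMap.smul_apply, smul_eq_mul,
      hm, hJ, hθ, hM, hp, h.symm P m]
    match_scalars
    · linear_combination -g m P * hδ
    · ring
    · ring
    · linear_combination (2 * g m P - k * g ξ P) * hδ
  have hT1 : g ξ (linType 1 g J ξ ((k / 2) • ξ + m) X Y - linType 1 g J ξ ((k / 2) • ξ + m) Y X) =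
      2 * (g m X * g ξ Y - g m Y * g ξ X) := by
    simp only [linType, map_add, map_sub, map_smul, LinearMap.add_apply, LinearMap.smul_apply,
      smul_eq_mul, hJ, hθ, hM, h.null]
    linear_combination (2 * (g m X * g ξ Y - g m Y * g ξ X)) * hδ
  have hT2 : g m (linType 1 g J ξ ((k / 2) • ξ + m) X Y - linType 1 g J ξ ((k / 2) • ξ + m) Y X) =
      -k * (g m X * g ξ Y - g m Y * g ξ X) := by
    simp only [linType, map_add, map_sub, map_smul, LinearMap.add_apply, LinearMap.smul_apply,
      smul_eq_mul, hJ, hθ, hM, hp, h.symm m ξ]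
    linear_combination ((1 - k) * (g m X * g ξ Y - g m Y * g ξ X)) * hδ
  have hξm : linCurv 1 g J R ξ ((k / 2) • ξ + m) X Y m = 0 := by
    have : linCurv 1 g J R ξ ((k / 2) • ξ + m) X Y ((k / 2) • ξ + m) =
        (k / 2) • linCurv 1 g J R ξ ((k / 2) • ξ + m) X Y ξ +
          linCurv 1 g J R ξ ((k / 2) • ξ + m) X Y m := by
      simp only [linCurv, linType_add_right, linType_smul_right, map_add, map_smul]
      module
    rw [h.curv_xi, h0] at this
    simpa using this.symm
  simp only [linCurv, hS, hT1, hT2, linType_smul_right] at hξm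
  linear_combination (norm := module) hξm

/-- The vector `m` vanishes. -/
theorem eq_zero_of_eigenvector [FiniteDimensional ℝ V] (hV : 4 ≤ finrank ℝ V)
    (h : LinearTypeCurvature 1 g J R ξ ((k / 2) • ξ + m))
    (hδ : δ * δ = 1) (hJ : J ξ = δ • ξ) (hm : J m = -δ • m) : m = 0 := by
  by_contra hm0
  have hp := h.inner_eq_zero_of_eigenvector hV hδ hJ hm
  have hθ := h.apply_J_of_eigenvector hJ
  have hM := h.apply_J_of_eigenvector hm
  have hmm := h.null_of_eigenvector (δ := -δ) (by linear_combination hδ) hm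
  have hRm := h.curv_of_eigenvector hδ hJ hm hp
  have hRξ (X Y : V) : R X Y ξ = (-4 * (1 + k) * (g m X * g ξ Y - g m Y * g ξ X)) • ξ := by
    rw [h.curv_xi_of_eigenvector hδ hJ hm, hp]
    ring_nf
  -- Eigenspaces of `J` for the same eigenvalue are orthogonal, so projecting a vector `e` with
  -- `g(ξ, e) = 1` to the `-δ`-eigenspace keeps this value and makes `g(m, e)` zero. The vector `Y`
  -- below is obtained from the opposite projection.
  obtain ⟨e, he, hme, hJe⟩ : ∃ e, g ξ e = 1 ∧ g m e = 0 ∧ J e = -δ • e := by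
    obtain ⟨e, he⟩ := h.exists_eq_one h.ne_zero
    refine ⟨(1 / 2 : ℝ) • (e - δ • J e), ?_, ?_, ?_⟩
    · simp only [map_smul, map_sub, smul_eq_mul, hθ, he]
      linear_combination (1 / 2) * hδ
    · simp only [map_smul, map_sub, smul_eq_mul, hM]
      linear_combination (-1 / 2 * g m e) * hδ
    · simp only [map_smul, map_sub, h.sq]
      match_scalars <;> first | ring1 | linear_combination (-1 / 2) * hδ
  obtain ⟨Y, hY, hJY⟩ : ∃ Y, g m Y = 1 ∧ J Y = δ • Y := by
    obtain ⟨Y, hY⟩ := h.exists_eq_one hm0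
    refine ⟨(1 / 2 : ℝ) • (Y + δ • J Y), ?_, ?_⟩
    · simp only [map_smul, map_add, smul_eq_mul, hM, hY]
      linear_combination (1 / 2) * hδ
    · simp only [map_smul, map_add, h.sq]
      match_scalars <;> first | ring1 | linear_combination (-1 / 2) * hδ
  have hξY : g ξ Y = 0 := by
    have := hθ Y
    rw [hJY, map_smul, smul_eq_mul] at this
    linear_combination (δ / 2) * this - g ξ Y * hδ
  have hSξ (A : V) : linType 1 g J ξ ((k / 2) • ξ + m) ξ A = 0 := by
    simp only [linType, map_add, map_smul, LinearMap.add_apply, LinearMap.smul_apply, smul_eq_mul,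
      hJ, hθ, hp, h.null, h.symm m ξ, mul_zero, add_zero, zero_smul, sub_zero]
    module
  have hSm (A : V) : linType 1 g J ξ ((k / 2) • ξ + m) m A =
      (2 : ℝ) • (g m A • ξ - g ξ A • m) := by
    simp only [linType, map_add, map_smul, LinearMap.add_apply, LinearMap.smul_apply, smul_eq_mul,
      hJ, hm, hθ, hM, hp, hmm]
    match_scalars
    · linear_combination g m A * hδ
    · linear_combination -g ξ A * hδ
    · ring
  have hSY (A : V) : linType 1 g J ξ ((k / 2) • ξ + m) Y A = (-2 * δ) • J A := by
    simp only [linType, map_add, map_smul, LinearMap.add_apply, LinearMap.smul_apply, smul_eq_mul,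
      hJ, hθ, hY, hJY, hξY]
    have h1 := h.skew Y A
    rw [hJY, map_smul, LinearMap.smul_apply, smul_eq_mul] at h1
    match_scalars
    · linear_combination δ * h1 - g Y A * hδ
    · linear_combination g ξ A * hδ
    · ring
  have hSe : linType 1 g J ξ ((k / 2) • ξ + m) e ξ = (2 + k) • ξ := by
    simp only [linType, map_add, map_smul, LinearMap.add_apply, LinearMap.smul_apply, smul_eq_mul,
      hJ, hJe, he, hme, h.null, h.symm e ξ, mul_zero, zero_smul, sub_zero]
    match_scalars
    linear_combination (1 + k) * hδ
  have hRe (A : V) : R ξ e A = (-4 * (1 + k)) • (g m A • ξ - g ξ A • m) := h.ext fun B ↦ by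
    rw [h.pair, hRξ]
    simp only [map_smul, map_sub, LinearMap.smul_apply, LinearMap.sub_apply, smul_eq_mul, he]
    ring
  have hRY (A : V) : R Y m A = (-4 * k) • (g m A • ξ - g ξ A • m) := h.ext fun B ↦ by
    rw [h.pair, h.skew', hRm]
    simp only [map_smul, map_sub, LinearMap.smul_apply, LinearMap.sub_apply, smul_eq_mul, hY]
    ring
  have hc1 (A : V) : linCurv 1 g J R ξ ((k / 2) • ξ + m) ξ e A =
      (-4 * (1 + k)) • (g m A • ξ - g ξ A • m) := by
    rw [linCurv, hSξ, hSξ, hSξ, linType_sub_left, hSe, linType_smul_left, hSξ, hRe]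
    simp [linType]
  have hc2 (A : V) : linCurv 1 g J R ξ ((k / 2) • ξ + m) Y m A =
      (4 * (1 - k)) • (g m A • ξ - g ξ A • m) := by
    rw [linCurv]
    simp only [hSY, hSm, linType_sub_left, linType_smul_left, map_smul, map_sub, hM, hθ, hJ, hm,
      hSξ, hY, hξY, hRY, zero_smul, sub_zero, one_smul]
    match_scalars
    · linear_combination (4 * g m A) * hδ
    · linear_combination (-4 * g ξ A) * hδ
  -- The curvature at `(ξ, e)` and at `(Y, m)` is a multiple of the same endomorphism `A ↦ g(m,A)ξ -
  -- g(ξ,A)m`, with factors `-4(1+k)` and `4(1-k)`. These never vanish together, so this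
  -- endomorphism annihilates `R`.
  have hΩ : ∃ c : ℝ, c ≠ 0 ∧ ∃ P Q, ∀ A, linCurv 1 g J R ξ ((k / 2) • ξ + m) P Q A =
      c • (g m A • ξ - g ξ A • m) := by
    by_cases hk : k = 1
    · exact ⟨_, by rw [hk]; norm_num, ξ, e, hc1⟩
    · exact ⟨_, mul_ne_zero four_ne_zero (sub_ne_zero.2 (Ne.symm hk)), Y, m, hc2⟩
  obtain ⟨c, hc, P, Q, hPQ⟩ := hΩ
  -- The endomorphism sends `Y` to `ξ` and `e` to `-m`, so all terms are known. The dependence on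
  -- `k` cancels and `8c = 0` remains.
  have h1 := congrArg (fun v ↦ g v e) (h.curv_curv P Q Y e Y)
  simp only [hPQ, hY, hξY, he, hme, map_smul, map_add, map_sub, LinearMap.smul_apply,
    LinearMap.add_apply, LinearMap.sub_apply, hRξ, zero_smul, one_smul, sub_zero, zero_sub,
    map_neg, LinearMap.neg_apply] at h1
  rw [h.symm m, h.symm ξ, h.skew' Y e Y m, h.skew' Y e Y ξ, hRm, hRξ, hRe, hRY] at h1
  simp only [map_smul, map_sub, LinearMap.smul_apply, LinearMap.sub_apply, smul_eq_mul, hY, he,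
    hme, hξY] at h1
  exact hc (by linear_combination h1 / 8)

end Eigenvector

theorem of_eigenvector [FiniteDimensional ℝ V] (hV : 4 ≤ finrank ℝ V)
    (h : LinearTypeCurvature 1 g J R ξ ζ) {δ : ℝ} (hδ : δ * δ = 1) (hJ : J ξ = δ • ξ) :
    (∃ c : ℝ, ζ = c • ξ) ∧ ∀ X Y, R X Y ξ = 0 := by
  obtain ⟨k, m, rfl, hm⟩ := h.exists_decomposition_of_eigenvector hδ hJ
  have hm0 := h.eq_zero_of_eigenvector hV hδ hJ hm
  refine ⟨⟨k / 2, by rw [hm0, add_zero]⟩, fun X Y ↦ ?_⟩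
  rw [h.curv_xi_of_eigenvector hδ hJ hm, hm0]
  simp

/-- The Ricci contraction of `R` vanishes. -/
theorem trace_eq_zero_of_curv_xi [FiniteDimensional ℝ V] (h : LinearTypeCurvature ε g J R ξ ζ)
    (hξ : ∀ X Y, R X Y ξ = 0) {e : V} (he : g ξ e = 1) (he' : ε = 1 ∨ g (J ξ) e = 0) (X Y : V) :
    LinearMap.trace ℝ V ((R.flip X).flip Y) = 0 := by
  set ric : V → V → ℝ := fun X Y ↦ LinearMap.trace ℝ V ((R.flip X).flip Y) with hric
  have hJξ (X Y : V) : R X Y (J ξ) = 0 := by rw [h.endo, hξ, map_zero]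
  have hξ1 (X Y Z : V) : g (R X Y Z) ξ = 0 := by rw [h.skew', hξ]; simp
  have hξ2 (X Y Z : V) : g (R X Y Z) (J ξ) = 0 := by rw [h.skew', hJξ]; simp
  have hξ3 (X Y Z : V) : g (R (J ξ) X Y) Z = 0 := by rw [h.pair, hJξ]; simp
  -- All terms of `bianchi_reduced` in which `ξ` or `Jξ` enters the curvature vanish, leaving only
  -- the cyclic sum.
  have hcyc (X Y Z A : V) : g ξ X • R Y Z A + g ξ Y • R Z X A + g ξ Z • R X Y A = 0 :=
    h.nondeg _ fun U ↦ by
      have h0 := h.bianchi_reduced X Y Z A U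
      simp only [hξ, hJξ, hξ1, hξ2, hξ3, map_zero, LinearMap.zero_apply] at h0
      simp only [map_add, map_smul, LinearMap.add_apply, LinearMap.smul_apply, smul_eq_mul]
      linear_combination h0 / 2
  -- Trace of the cyclic identity over `X`; the rank-one term has trace `g(ξ, R(Y,Z)A) = 0`.
  have hprop (Y Z A : V) : g ξ Z * ric Y A = g ξ Y * ric Z A := by
    have h0 : (g ξ).smulRight (R Y Z A) - g ξ Y • (R.flip Z).flip A + g ξ Z • (R.flip Y).flip A =
        0 := by
      ext X
      have := hcyc X Y Z A
      rw [h.swap Z X] at this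
      simp only [LinearMap.add_apply, LinearMap.sub_apply, LinearMap.smul_apply,
        LinearMap.smulRight_apply, LinearMap.flip_apply, LinearMap.zero_apply]
      linear_combination (norm := module) this
    have h1 := congrArg (LinearMap.trace ℝ V) h0
    simp only [map_add, map_sub, map_smul, map_zero, LinearMap.trace_smulRight, smul_eq_mul,
      h.symm ξ (R Y Z A), hξ1] at h1
    linear_combination h1
  have hsymm (Y Z : V) : ric Y Z = ric Z Y := by
    have h0 : (R.flip Y).flip Z - (R.flip Z).flip Y = -R Y Z := by
      ext X
      have := h.cyclic X Y Z
      rw [h.swap Z X] at this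
      simp only [LinearMap.sub_apply, LinearMap.flip_apply, LinearMap.neg_apply]
      linear_combination (norm := module) this
    have h1 := congrArg (LinearMap.trace ℝ V) h0
    have h2 := h.trace_eq_zero (A := R Y Z) (h.skewR Y Z)
    rw [map_sub, map_neg, h2] at h1
    linear_combination h1
  have hJric (Y Z : V) : ric (J Y) (J Z) = -ε * ric Y Z := by
    have h0 : (R.flip (J Y)).flip (J Z) = -(J ∘ₗ (R.flip Y).flip Z ∘ₗ J) := by
      ext X
      simp only [LinearMap.flip_apply, LinearMap.neg_apply, LinearMap.comp_apply]
      rw [h.endo, h.J_left, map_neg, neg_neg]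
    have h1 : ((R.flip Y).flip Z ∘ₗ J) ∘ₗ J = ε • (R.flip Y).flip Z := by
      ext X
      simp [h.sq]
    simp only [hric]
    rw [h0, map_neg, LinearMap.trace_comp_comm', h1, map_smul, smul_eq_mul, neg_mul]
  have hκ (Y Z : V) : ric Y Z = g ξ Y * g ξ Z * ric e e := by
    have h1 := hprop Y e Z
    have h2 := hprop Z e e
    rw [he, one_mul] at h1 h2
    rw [h1, hsymm e Z, h2]
    ring
  have h0 : ric e e = 0 := by
    have h1 := hJric e e
    rw [hκ (J e)] at h1
    -- For `ε = 1` the equation is `(g(ξ, Je)² + 1) ric(e,e) = 0`; in the other case `g(ξ, Je) = 0`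
    -- and it reads `0 = -ε ric(e,e)`.
    rcases he' with rfl | he'
    · have : (g ξ (J e) * g ξ (J e) + 1) * ric e e = 0 := by linear_combination h1
      exact (mul_eq_zero.1 this).resolve_left (by nlinarith [mul_self_nonneg (g ξ (J e))])
    · rw [h.skew] at he'
      linear_combination ε * h1 - ric e e * h.eps_sq + ε * g ξ (J e) * ric e e * he'
  exact (hκ X Y).trans (by rw [h0, mul_zero])

/-- The pointwise conclusion: the Ricci contraction vanishes and `ζ` is a multiple of `ξ`. -/
theorem trace_eq_zero_and_exists_smul [FiniteDimensional ℝ V] (hV : 4 ≤ finrank ℝ V)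
    (h : LinearTypeCurvature ε g J R ξ ζ) :
    (∀ X Y, LinearMap.trace ℝ V ((R.flip X).flip Y) = 0) ∧
    ∃ c : ℝ, ζ = c • ξ ∧ ((ε = -1 ∨ J ξ ≠ ξ ∧ J ξ ≠ -ξ) → c = 0 ∨ c = -ε / 2) := by
  rcases h.dichotomy h.ne_zero with ⟨e, he, he'⟩ | ⟨rfl, δ, hδ, hJ⟩
  · obtain ⟨⟨c, hc, hc'⟩, hξ⟩ := h.of_independent he he'
    exact ⟨h.trace_eq_zero_of_curv_xi hξ he (Or.inr he'), c, hc, fun _ ↦ hc'⟩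
  · obtain ⟨⟨c, hc⟩, hξ⟩ := h.of_eigenvector hV hδ hJ
    obtain ⟨e, he⟩ := h.exists_eq_one h.ne_zero
    refine ⟨h.trace_eq_zero_of_curv_xi hξ he (Or.inl rfl), c, hc, ?_⟩
    rintro (h1 | ⟨h1, h2⟩)
    · norm_num at h1
    · rcases mul_self_eq_one_iff.1 hδ with rfl | rfl
      · exact absurd (by rw [hJ, one_smul]) h1
      · exact absurd (by rw [hJ, neg_one_smul]) h2

end LinearTypeCurvature

end CurvatureCases

/-! ### The pointwise data of a homogeneous structure of linear type -/

section Pointwise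

open VectorField LinearConnection

variable [FiniteDimensional ℝ E] {g : PseudoRiemannianMetric E M} {D : LinearConnection E M}
  {J : EndField E M} {S : TensorField12 E M} {ξ ζ : VField E M} {ε : ℝ}

instance tangentSpace_finiteDimensional (x : M) :
    FiniteDimensional ℝ (TangentSpace 𝓘(ℝ, E) x) := inferInstanceAs (FiniteDimensional ℝ E)

/-- The metric at a point as a bilinear map. -/
def PseudoRiemannianMetric.bilin (g : PseudoRiemannianMetric E M) (x : M) :
    TangentSpace 𝓘(ℝ, E) x →ₗ[ℝ] TangentSpace 𝓘(ℝ, E) x →ₗ[ℝ] ℝ :=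
  LinearMap.mk₂ ℝ (fun v w ↦ g.inner x v w) (by simp) (by simp) (by simp) (by simp)

theorem PseudoRiemannianMetric.bilin_apply (x : M) (v w : TangentSpace 𝓘(ℝ, E) x) :
    g.bilin x v w = g.inner x v w := rfl

theorem IsEpsKahler.epsHermitian (hε : ε = -1 ∨ ε = 1) (hJ : IsEpsKahler ε g D J) (x : M) :
    EpsHermitian ε (g.bilin x) (J x : TangentSpace 𝓘(ℝ, E) x →ₗ[ℝ] TangentSpace 𝓘(ℝ, E) x) where
  eps := hε
  symm := g.symm x
  nondeg := g.nondegenerate x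
  skew := hJ.skew x
  sq := hJ.sq x

theorem LinearConnection.along_const_smul_right (X : VField E M) (c : ℝ) {Y : VField E M}
    (hY : SmoothVField Y) : D.along X (c • Y) = c • D.along X Y := by
  ext1 x
  have := D.isCovariantDerivativeOnUniv.smul_const c (hY.diff x)
  simp [along, this]

theorem IsLinearType.eq_linType (h : IsLinearType ε g J S ξ ζ) (x : M)
    (u v : TangentSpace 𝓘(ℝ, E) x) : S x u v = linType ε (g.bilin x)
      (J x : TangentSpace 𝓘(ℝ, E) x →ₗ[ℝ] TangentSpace 𝓘(ℝ, E) x) (ξ x) (ζ x) u v :=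
  h.eq x u v

variable [T2Space M]

/-- The vector fields defining a homogeneous structure of linear type are parallel with respect
to `D - S`. -/
theorem IsLinearType.parallel (hdim : 4 ≤ finrank ℝ E) (hε : ε = -1 ∨ ε = 1)
    (hJ : IsEpsKahler ε g D J) (hS : IsHomogeneousStructure g D J S)
    (hlin : IsLinearType ε g J S ξ ζ) (x : M) (v : TangentSpace 𝓘(ℝ, E) x) :
    subTensor D S ξ x v = 0 ∧ subTensor D S ζ x v = 0 := by
  obtain ⟨X, hX, rfl⟩ := exists_smoothVField v
  refine (hJ.epsHermitian hε x).eq_zero_of_linType_eq_zero hdim fun y z ↦ ?_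
  obtain ⟨Y, hY, rfl⟩ := exists_smoothVField y
  obtain ⟨Z, hZ, rfl⟩ := exists_smoothVField z
  have hξ := hlin.smooth_xi
  have hζ := hlin.smooth_zeta
  have hJs {W : VField E M} (hW : SmoothVField W) := SmoothVField.endo hJ.smooth hW
  have key : (fun y ↦ S y (Y y) (Z y)) =
      (fun y ↦ g.inner y (Y y) (Z y)) • ξ - (fun y ↦ g.inner y (ξ y) (Z y)) • Y +
        ε • ((fun y ↦ g.inner y (Y y) (J y (Z y))) • fun y ↦ J y (ξ y)) -
        ε • ((fun y ↦ g.inner y (ξ y) (J y (Z y))) • fun y ↦ J y (Y y)) -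
        (2 : ℝ) • ((fun y ↦ g.inner y (ζ y) (J y (Y y))) • fun y ↦ J y (Z y)) := by
    ext1 y
    have := hlin.eq y (Y y) (Z y)
    simp only [mul_smul] at this
    exact this
  set D' := subTensor D S
  have h1 := g.smooth_inner hY hZ
  have h2 := g.smooth_inner hξ hZ
  have h3 := g.smooth_inner hY (hJs hZ)
  have h4 := g.smooth_inner hξ (hJs hZ)
  have h5 := g.smooth_inner hζ (hJs hY)
  have t1 := hξ.smul h1
  have t2 := hY.smul h2
  have t3 := (hJs hξ).smul h3
  have t4 := (hJs hY).smul h4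
  have t5 := (hJs hZ).smul h5
  -- Differentiate both sides of `key`. The terms containing derivatives of `Y` and `Z` cancel
  -- because `S` has the same form on them; what is left is the linear type tensor built from the
  -- derivatives of `ξ` and `ζ`.
  have h := hS.tensor.along_apply X hY hZ
  rw [key, D'.along_sub_right X (((t1.sub t2).add (t3.const_smul ε)).sub (t4.const_smul ε))
      (t5.const_smul 2), D'.along_sub_right X ((t1.sub t2).add (t3.const_smul ε)) (t4.const_smul ε),
    D'.along_add_right X (t1.sub t2) (t3.const_smul ε), D'.along_sub_right X t1 t2,
    along_const_smul_right X ε t3, along_const_smul_right X ε t4, along_const_smul_right X 2 t5,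
    D'.along_smul_right X h1 hξ, D'.along_smul_right X h2 hY, D'.along_smul_right X h3 (hJs hξ),
    D'.along_smul_right X h4 (hJs hY), D'.along_smul_right X h5 (hJs hZ),
    hS.metric.dirDeriv_inner X hY hZ, hS.metric.dirDeriv_inner X hξ hZ,
    hS.metric.dirDeriv_inner X hY (hJs hZ), hS.metric.dirDeriv_inner X hξ (hJs hZ),
    hS.metric.dirDeriv_inner X hζ (hJs hY), hS.endo.along_apply X hξ, hS.endo.along_apply X hY,
    hS.endo.along_apply X hZ] at h
  have h' := congrFun h x
  simp only [Pi.add_apply, Pi.sub_apply, Pi.smul_apply, Pi.smul_apply', hlin.eq] at h'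
  have a1 : D' ξ x (X x) = D'.along X ξ x := rfl
  have a2 : D' ζ x (X x) = D'.along X ζ x := rfl
  rw [a1, a2]
  simp only [linType, PseudoRiemannianMetric.bilin_apply, ContinuousLinearMap.coe_coe]
  linear_combination (norm := module) h'

/-- The curvature tensor at a point as a trilinear map. -/
def curvatureMap (hD : D.ContMDiffCovariantDerivative ∞) (x : M) :
    TangentSpace 𝓘(ℝ, E) x →ₗ[ℝ] TangentSpace 𝓘(ℝ, E) x →ₗ[ℝ] TangentSpace 𝓘(ℝ, E) x →ₗ[ℝ]
      TangentSpace 𝓘(ℝ, E) x :=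
  have add1 (u u' v w : TangentSpace 𝓘(ℝ, E) x) :
      curvature D x (u + u') v w = curvature D x u v w + curvature D x u' v w := by
    obtain ⟨U, hU, rfl⟩ := exists_smoothVField u
    obtain ⟨U', hU', rfl⟩ := exists_smoothVField u'
    obtain ⟨V, hV, rfl⟩ := exists_smoothVField v
    obtain ⟨W, hW, rfl⟩ := exists_smoothVField w
    rw [← Pi.add_apply, curvature_eq_curvOp hD (hU.add hU') hV hW, curvature_eq_curvOp hD hU hV hW,
      curvature_eq_curvOp hD hU' hV hW, curvOp_add_left hD hU hU' hW, Pi.add_apply]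
  have smul1 (c : ℝ) (u v w : TangentSpace 𝓘(ℝ, E) x) :
      curvature D x (c • u) v w = c • curvature D x u v w := by
    obtain ⟨U, hU, rfl⟩ := exists_smoothVField u
    obtain ⟨V, hV, rfl⟩ := exists_smoothVField v
    obtain ⟨W, hW, rfl⟩ := exists_smoothVField w
    have hc : SmoothFun (E := E) (fun _ : M ↦ c) := contMDiff_const
    have h1 := curvature_eq_curvOp hD (hU.smul hc) hV hW x
    rw [curvOp_smul_left hD hU hW hc] at h1
    rw [curvature_eq_curvOp hD hU hV hW]
    exact h1
  have swap (u v w : TangentSpace 𝓘(ℝ, E) x) : curvature D x u v w = -curvature D x v u w := by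
    obtain ⟨U, hU, rfl⟩ := exists_smoothVField u
    obtain ⟨V, hV, rfl⟩ := exists_smoothVField v
    obtain ⟨W, hW, rfl⟩ := exists_smoothVField w
    rw [curvature_eq_curvOp hD hU hV hW, curvature_eq_curvOp hD hV hU hW, curvOp_swap, Pi.neg_apply]
  LinearMap.mk₂ ℝ
    (fun u v ↦
      { toFun := fun w ↦ curvature D x u v w
        map_add' := fun w w' ↦ by
          obtain ⟨U, hU, rfl⟩ := exists_smoothVField u
          obtain ⟨V, hV, rfl⟩ := exists_smoothVField v
          obtain ⟨W, hW, rfl⟩ := exists_smoothVField w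
          obtain ⟨W', hW', rfl⟩ := exists_smoothVField w'
          rw [← Pi.add_apply, curvature_eq_curvOp hD hU hV (hW.add hW'),
            curvature_eq_curvOp hD hU hV hW, curvature_eq_curvOp hD hU hV hW',
            curvOp_add_right hD hU hV hW hW', Pi.add_apply]
        map_smul' := fun c w ↦ by
          obtain ⟨U, hU, rfl⟩ := exists_smoothVField u
          obtain ⟨V, hV, rfl⟩ := exists_smoothVField v
          obtain ⟨W, hW, rfl⟩ := exists_smoothVField w
          have hc : SmoothFun (E := E) (fun _ : M ↦ c) := contMDiff_const
          have h1 := curvature_eq_curvOp hD hU hV (hW.smul hc) x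
          rw [curvOp_smul_right hD hU hV hW hc] at h1
          rw [curvature_eq_curvOp hD hU hV hW]
          exact h1 })
    (fun u u' v ↦ LinearMap.ext fun w ↦ add1 u u' v w)
    (fun c u v ↦ LinearMap.ext fun w ↦ smul1 c u v w)
    (fun u v v' ↦ LinearMap.ext fun w ↦ by
      change curvature D x u (v + v') w = curvature D x u v w + curvature D x u v' w
      rw [swap, add1, swap v, swap v']
      abel)
    (fun c u v ↦ LinearMap.ext fun w ↦ by
      change curvature D x u (c • v) w = c • curvature D x u v w
      rw [swap, smul1, swap v, smul_neg, neg_neg])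

theorem curvatureMap_apply (hD : D.ContMDiffCovariantDerivative ∞) (x : M)
    (u v w : TangentSpace 𝓘(ℝ, E) x) : curvatureMap hD x u v w = curvature D x u v w := rfl

theorem ricci_eq_trace (hD : D.ContMDiffCovariantDerivative ∞) (x : M)
    (v w : TangentSpace 𝓘(ℝ, E) x) :
    ricci D x v w = LinearMap.trace ℝ _ (((curvatureMap hD x).flip v).flip w) := by
  let b : Basis (Fin (finrank ℝ E)) ℝ (TangentSpace 𝓘(ℝ, E) x) := finBasis ℝ E
  rw [LinearMap.trace_eq_matrix_trace ℝ b]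
  simp only [Matrix.trace, Matrix.diag_apply, LinearMap.toMatrix_apply]
  rfl

theorem curvOp_subTensor_eq_linCurv (hD : IsLeviCivita g D) (hS : IsHomogeneousStructure g D J S)
    (hlin : IsLinearType ε g J S ξ ζ) {X Y Z : VField E M} (hX : SmoothVField X)
    (hY : SmoothVField Y) (hZ : SmoothVField Z) (x : M) :
    (subTensor D S).curvOp X Y Z x = linCurv ε (g.bilin x)
      (J x : TangentSpace 𝓘(ℝ, E) x →ₗ[ℝ] TangentSpace 𝓘(ℝ, E) x) (curvatureMap hD.smooth x)
      (ξ x) (ζ x) (X x) (Y x) (Z x) := by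
  rw [curvOp_subTensor hD hS.smooth hS.tensor hX hY hZ, linCurv]
  simp only [← hlin.eq_linType]
  rw [curvatureMap_apply, curvature_eq_curvOp hD.smooth hX hY hZ]

/-- The geometry enters the algebra only here: each field of `LinearTypeCurvature` is the value at
`x` of an identity between smooth vector fields. -/
theorem IsLinearType.linearTypeCurvature (hdim : 4 ≤ finrank ℝ E) (hε : ε = -1 ∨ ε = 1)
    (hD : IsLeviCivita g D) (hJ : IsEpsKahler ε g D J) (hS : IsHomogeneousStructure g D J S)
    (hlin : IsLinearType ε g J S ξ ζ) (x : M) (hx : ξ x ≠ 0) (hnull : g.inner x (ξ x) (ξ x) = 0) :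
    LinearTypeCurvature ε (g.bilin x)
      (J x : TangentSpace 𝓘(ℝ, E) x →ₗ[ℝ] TangentSpace 𝓘(ℝ, E) x) (curvatureMap hD.smooth x)
      (ξ x) (ζ x) where
  toEpsHermitian := hJ.epsHermitian hε x
  ne_zero := hx
  null := hnull
  swap u v w := by
    obtain ⟨U, hU, rfl⟩ := exists_smoothVField u
    obtain ⟨V, hV, rfl⟩ := exists_smoothVField v
    obtain ⟨W, hW, rfl⟩ := exists_smoothVField w
    rw [curvatureMap_apply, curvatureMap_apply, curvature_eq_curvOp hD.smooth hU hV hW,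
      curvature_eq_curvOp hD.smooth hV hU hW, curvOp_swap, Pi.neg_apply]
  skewR u v w z := by
    have : Nontrivial E := nontrivial_of_finrank_pos (R := ℝ) (by omega)
    obtain ⟨U, hU, rfl⟩ := exists_smoothVField u
    obtain ⟨V, hV, rfl⟩ := exists_smoothVField v
    obtain ⟨W, hW, rfl⟩ := exists_smoothVField w
    obtain ⟨Z, hZ, rfl⟩ := exists_smoothVField z
    rw [curvatureMap_apply, curvatureMap_apply, curvature_eq_curvOp hD.smooth hU hV hW,
      curvature_eq_curvOp hD.smooth hU hV hZ]
    exact curvOp_metric_skew hD.smooth hD.metric hU hV hW hZ x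
  endo u v w := by
    obtain ⟨U, hU, rfl⟩ := exists_smoothVField u
    obtain ⟨V, hV, rfl⟩ := exists_smoothVField v
    obtain ⟨W, hW, rfl⟩ := exists_smoothVField w
    have h1 := curvature_eq_curvOp hD.smooth hU hV (SmoothVField.endo hJ.smooth hW) x
    rw [curvOp_endo hD.smooth hJ.parallel hU hV hW, ← curvature_eq_curvOp hD.smooth hU hV hW] at h1
    exact h1
  cyclic u v w := by
    obtain ⟨U, hU, rfl⟩ := exists_smoothVField u
    obtain ⟨V, hV, rfl⟩ := exists_smoothVField v
    obtain ⟨W, hW, rfl⟩ := exists_smoothVField w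
    simp only [curvatureMap_apply]
    rw [curvature_eq_curvOp hD.smooth hU hV hW, curvature_eq_curvOp hD.smooth hV hW hU,
      curvature_eq_curvOp hD.smooth hW hU hV]
    exact congrFun (hD.curvOp_cyclic hU hV hW) x
  curv_xi u v := by
    obtain ⟨U, hU, rfl⟩ := exists_smoothVField u
    obtain ⟨V, hV, rfl⟩ := exists_smoothVField v
    rw [← curvOp_subTensor_eq_linCurv hD hS hlin hU hV hlin.smooth_xi, curvOp_eq_zero_of_parallel]
    · rfl
    · exact fun X ↦ funext fun y ↦ (hlin.parallel hdim hε hJ hS y (X y)).1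
  curv_zeta u v := by
    obtain ⟨U, hU, rfl⟩ := exists_smoothVField u
    obtain ⟨V, hV, rfl⟩ := exists_smoothVField v
    rw [← curvOp_subTensor_eq_linCurv hD hS hlin hU hV hlin.smooth_zeta, curvOp_eq_zero_of_parallel]
    · rfl
    · exact fun X ↦ funext fun y ↦ (hlin.parallel hdim hε hJ hS y (X y)).2
  curv_curv u v a b c := by
    obtain ⟨U, hU, rfl⟩ := exists_smoothVField u
    obtain ⟨V, hV, rfl⟩ := exists_smoothVField v
    obtain ⟨A, hA, rfl⟩ := exists_smoothVField a
    obtain ⟨B, hB, rfl⟩ := exists_smoothVField b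
    obtain ⟨C, hC, rfl⟩ := exists_smoothVField c
    have hs := hD.smooth
    have sm {Z : VField E M} (hZ : SmoothVField Z) :
        SmoothVField ((subTensor D S).curvOp U V Z) :=
      ((hU.subTensor_along hs hS.smooth (hV.subTensor_along hs hS.smooth hZ)).sub
        (hV.subTensor_along hs hS.smooth (hU.subTensor_along hs hS.smooth hZ))).sub
        ((hU.bracket hV).subTensor_along hs hS.smooth hZ)
    have h := congrFun (curvOp_subTensor_curvOp hD hS.smooth hS.curvature hU hV hA hB hC) x
    rw [Pi.add_apply, Pi.add_apply, curvOp_subTensor_eq_linCurv hD hS hlin hU hV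
      (hA.curvOp hs hB hC), ← curvature_eq_curvOp hs hA hB hC,
      ← curvature_eq_curvOp hs (sm hA) hB hC, ← curvature_eq_curvOp hs hA (sm hB) hC,
      ← curvature_eq_curvOp hs hA hB (sm hC), curvOp_subTensor_eq_linCurv hD hS hlin hU hV hA,
      curvOp_subTensor_eq_linCurv hD hS hlin hU hV hB,
      curvOp_subTensor_eq_linCurv hD hS hlin hU hV hC] at h
    exact h
  bianchi u v w a := by
    simp only [← hlin.eq_linType, curvatureMap_apply]
    exact bianchi_of_parallel hD hS.smooth hS.curvature x u v w a

end Pointwise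

/-! ### Parallel vector fields vanishing at a point -/

section Propagation

open VectorField LinearConnection

/-- The derivative of a function in a chart, in terms of the trivialization of the tangent
bundle. -/
theorem hasFDerivAt_comp_extChartAt_symm [FiniteDimensional ℝ E] {f : M → ℝ}
    (hf : SmoothFun (E := E) f) {x y : M} (hy : y ∈ (chartAt E x).source) :
    ∃ L : E →L[ℝ] ℝ, HasFDerivAt (f ∘ (extChartAt 𝓘(ℝ, E) x).symm) L (extChartAt 𝓘(ℝ, E) x y) ∧
      ∀ v : E, L v =
        mvfderiv 𝓘(ℝ, E) f y ((trivializationAt E (TangentSpace 𝓘(ℝ, E)) x).symmL ℝ y v) := by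
  have hy' : y ∈ (extChartAt 𝓘(ℝ, E) x).source := by rwa [extChartAt_source]
  have h1 : MDifferentiableWithinAt 𝓘(ℝ, E) 𝓘(ℝ, E) (extChartAt 𝓘(ℝ, E) x).symm
      (Set.range 𝓘(ℝ, E)) (extChartAt 𝓘(ℝ, E) x y) :=
    mdifferentiableWithinAt_extChartAt_symm ((extChartAt 𝓘(ℝ, E) x).map_source hy')
  rw [ModelWithCorners.range_eq_univ, mdifferentiableWithinAt_univ] at h1
  have h2 := (hf.diff ((extChartAt 𝓘(ℝ, E) x).symm (extChartAt 𝓘(ℝ, E) x y))).hasMFDerivAt.comp _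
    h1.hasMFDerivAt
  refine ⟨_, h2.hasFDerivAt, fun v ↦ ?_⟩
  rw [TangentBundle.symmL_trivializationAt hy, ModelWithCorners.range_eq_univ, mfderivWithin_univ]
  have h3 := (extChartAt 𝓘(ℝ, E) x).left_inv hy'
  have h4 : ∀ y', y' = y → ∀ w : E, (mfderiv 𝓘(ℝ, E) 𝓘(ℝ, ℝ) f y' : E →L[ℝ] ℝ) w =
      (mfderiv 𝓘(ℝ, E) 𝓘(ℝ, ℝ) f y : E →L[ℝ] ℝ) w := by
    rintro _ rfl _
    rfl
  exact h4 _ h3 _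

/-- Functions which satisfy a linear first order system near a point and vanish at this point
vanish near this point. -/
theorem eventually_eq_zero_of_linear_system [FiniteDimensional ℝ E] {ι : Type*} [Fintype ι]
    (b : Basis ι ℝ E) {x : M} {f : ι → M → ℝ} (hf : ∀ i, SmoothFun (E := E) (f i))
    {c : ι → ι → ι → M → ℝ} (hc : ∀ k i j, SmoothFun (E := E) (c k i j))
    (h : ∀ᶠ y in nhds x, ∀ k i, mvfderiv 𝓘(ℝ, E) (f i) y
      ((trivializationAt E (TangentSpace 𝓘(ℝ, E)) x).symmL ℝ y (b k)) =
        ∑ j, c k i j y * f j y) (hx : ∀ i, f i x = 0) :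
    ∀ᶠ y in nhds x, ∀ i, f i y = 0 := by
  set ψ := extChartAt 𝓘(ℝ, E) x with hψ
  have hbound : ∀ᶠ y in nhds x, ∀ k i j, |c k i j y| ≤ |c k i j x| + 1 := by
    refine Filter.eventually_all.2 fun k ↦ Filter.eventually_all.2 fun i ↦
      Filter.eventually_all.2 fun j ↦ ?_
    have h1 : Continuous fun y ↦ |c k i j y| := (hc k i j).continuous.abs
    exact (h1.continuousAt.eventually_lt_const (lt_add_one _)).mono fun y hy ↦ hy.le
  obtain ⟨C, hC0, hC⟩ : ∃ C : ℝ, 0 ≤ C ∧ ∀ k i j, |c k i j x| + 1 ≤ C := by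
    refine ⟨∑ k, ∑ i, ∑ j, (|c k i j x| + 1), by positivity, fun k i j ↦ ?_⟩
    calc |c k i j x| + 1 ≤ ∑ j, (|c k i j x| + 1) :=
          Finset.single_le_sum (f := fun j ↦ |c k i j x| + 1) (fun _ _ ↦ by positivity)
            (Finset.mem_univ j)
      _ ≤ ∑ i, ∑ j, (|c k i j x| + 1) :=
          Finset.single_le_sum (f := fun i ↦ ∑ j, (|c k i j x| + 1)) (fun _ _ ↦ by positivity)
            (Finset.mem_univ i)
      _ ≤ _ := Finset.single_le_sum (f := fun k ↦ ∑ i, ∑ j, (|c k i j x| + 1))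
            (fun _ _ ↦ by positivity) (Finset.mem_univ k)
  have hsrc : ∀ᶠ y in nhds x, y ∈ (chartAt E x).source := chart_source_mem_nhds E x
  have hball : ∀ᶠ p in nhds (ψ x), p ∈ ψ.target ∧ ψ.symm p ∈ (chartAt E x).source ∧
      (∀ k i, mvfderiv 𝓘(ℝ, E) (f i) (ψ.symm p)
        ((trivializationAt E (TangentSpace 𝓘(ℝ, E)) x).symmL ℝ (ψ.symm p) (b k)) =
        ∑ j, c k i j (ψ.symm p) * f j (ψ.symm p)) ∧
      ∀ k i j, |c k i j (ψ.symm p)| ≤ C := by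
    have h1 : Filter.Tendsto ψ.symm (nhds (ψ x)) (nhds x) := by
      have := continuousAt_extChartAt_symm (I := 𝓘(ℝ, E)) x
      rwa [ContinuousAt, extChartAt_to_inv] at this
    filter_upwards [extChartAt_target_mem_nhds (I := 𝓘(ℝ, E)) x, h1.eventually hsrc,
      h1.eventually h, h1.eventually hbound] with p h1 h2 h3 h4
    exact ⟨h1, h2, h3, fun k i j ↦ (h4 k i j).trans (hC k i j)⟩
  obtain ⟨r, hr, hr'⟩ := Metric.eventually_nhds_iff_ball.1 hball
  have hzero : ∀ p ∈ Metric.ball (ψ x) r, ∀ i, f i (ψ.symm p) = 0 := by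
    intro p hp
    set u := p - ψ x with hu
    -- Along the segment from the centre of the chart ball to `p` the system becomes a linear
    -- ordinary differential equation with bounded coefficients and zero initial value, so
    -- Grönwall's inequality applies.
    set γ : ℝ → E := fun t ↦ ψ x + t • u with hγ
    have hγball (t : ℝ) (ht : t ∈ Set.Icc (0 : ℝ) 1) : γ t ∈ Metric.ball (ψ x) r := by
      rw [Metric.mem_ball, dist_eq_norm] at hp ⊢
      have : γ t - ψ x = t • u := by simp [hγ]
      rw [this, norm_smul, Real.norm_eq_abs, abs_of_nonneg ht.1]
      exact lt_of_le_of_lt (mul_le_of_le_one_left (norm_nonneg _) ht.2) hp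
    set F : ℝ → ι → ℝ := fun t i ↦ f i (ψ.symm (γ t)) with hF
    set F' : ℝ → ι → ℝ := fun t i ↦ ∑ k, b.repr u k * ∑ j, c k i j (ψ.symm (γ t)) * F t j with hF'
    have hderiv (t : ℝ) (ht : t ∈ Set.Icc (0 : ℝ) 1) : HasDerivAt F (F' t) t := by
      refine hasDerivAt_pi.2 fun i ↦ ?_
      obtain ⟨h1, h2, h3, -⟩ := hr' _ (hγball t ht)
      obtain ⟨L, hL, hL'⟩ := hasFDerivAt_comp_extChartAt_symm (hf i) h2
      rw [← hψ, ψ.right_inv h1] at hL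
      have h4 : HasDerivAt γ u t := by
        have := ((hasDerivAt_id t).smul_const u).const_add (ψ x)
        rwa [one_smul] at this
      have h5 := hL.comp_hasDerivAt t h4
      have h6 : L u = F' t i := by
        conv_lhs => rw [← b.sum_repr u]
        rw [map_sum]
        refine Finset.sum_congr rfl fun k _ ↦ ?_
        rw [map_smul, hL', h3, smul_eq_mul]
      rw [← h6]
      exact h5
    have hmain := eq_zero_of_abs_deriv_le_mul_abs_self_of_eq_zero_right (f := F) (f' := F')
      (a := 0) (b := 1) (K := ∑ k, |b.repr u k| * ∑ _j : ι, C)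
      (fun t ht ↦ (hderiv t ht).continuousAt.continuousWithinAt)
      (fun t ht ↦ (hderiv t ⟨ht.1, ht.2.le⟩).hasDerivWithinAt)
      (by
        ext i
        simp only [hF, hγ, zero_smul, add_zero, hψ, extChartAt_to_inv, hx, Pi.zero_apply])
      (fun t ht ↦ by
        obtain ⟨-, -, -, h4⟩ := hr' _ (hγball t ⟨ht.1, ht.2.le⟩)
        refine (pi_norm_le_iff_of_nonneg (by positivity)).2 fun i ↦ ?_
        rw [Finset.sum_mul]
        refine (norm_sum_le _ _).trans (Finset.sum_le_sum fun k _ ↦ ?_)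
        rw [norm_mul, Real.norm_eq_abs, mul_assoc]
        refine mul_le_mul_of_nonneg_left ?_ (abs_nonneg _)
        rw [Finset.sum_mul]
        refine (norm_sum_le _ _).trans (Finset.sum_le_sum fun j _ ↦ ?_)
        rw [norm_mul]
        exact mul_le_mul (h4 k i j) (norm_le_pi_norm (F t) j) (norm_nonneg _) hC0)
    intro i
    have := congrFun (hmain 1 ⟨zero_le_one, le_rfl⟩) i
    simpa [hF, hγ, hu] using this
  have h1 : ∀ᶠ y in nhds x, ψ y ∈ Metric.ball (ψ x) r :=
    (continuousAt_extChartAt (I := 𝓘(ℝ, E)) x).eventually (Metric.ball_mem_nhds _ hr)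
  filter_upwards [h1, hsrc] with y hy hy' i
  have h2 := hzero _ hy i
  rwa [hψ, (extChartAt 𝓘(ℝ, E) x).left_inv (by rwa [extChartAt_source])] at h2

variable [FiniteDimensional ℝ E] [T2Space M]

/-- A smooth vector field is near a point a combination of global smooth extensions of a local
frame. -/
theorem exists_smooth_coeff {ι : Type*} [Fintype ι] (b : Basis ι ℝ E) {x : M} {s : ι → VField E M}
    (hs : ∀ i, ∀ᶠ y in nhds x, s i y =
      (trivializationAt E (TangentSpace 𝓘(ℝ, E)) x).localFrame b i y)
    {Y : VField E M} (hY : SmoothVField Y) :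
    ∃ c : ι → M → ℝ, (∀ i, SmoothFun (E := E) (c i)) ∧
      ∀ᶠ y in nhds x, Y y = ∑ i, c i y • s i y := by
  let t := trivializationAt E (TangentSpace 𝓘(ℝ, E) : M → Type _) x
  have hxt : x ∈ t.baseSet := FiberBundle.mem_baseSet_trivializationAt' x
  have hc (i) := exists_smoothFun_eventuallyEq t.open_baseSet hxt
    (contMDiffOn_baseSet_localFrameCoeff (e := t) b (k := ∞) (I := 𝓘(ℝ, E)) (s := Y)
      hY.contMDiffOn i)
  choose c hc hc' using hc
  refine ⟨c, hc, ?_⟩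
  filter_upwards [t.eventually_eq_localFrame_sum_coeff_smul (I := 𝓘(ℝ, E)) (s := Y) b hxt,
    Filter.eventually_all.2 hs, Filter.eventually_all.2 hc'] with y h1 h2 h3
  rw [h1]
  simp [h2, h3, t]

/-- A parallel vector field which vanishes at a point vanishes near this point. -/
theorem eventually_eq_zero_of_parallel {g : PseudoRiemannianMetric E M} {D : LinearConnection E M}
    (hsm : ∀ {X Y : VField E M}, SmoothVField X → SmoothVField Y → SmoothVField (D.along X Y))
    (hg : ParallelMetric D g) {Z : VField E M} (hZ : SmoothVField Z)
    (hDZ : ∀ (x : M) (v : TangentSpace 𝓘(ℝ, E) x), D Z x v = 0) {x : M} (hx : Z x = 0) :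
    ∀ᶠ y in nhds x, Z y = 0 := by
  let t := trivializationAt E (TangentSpace 𝓘(ℝ, E) : M → Type _) x
  have hxt : x ∈ t.baseSet := FiberBundle.mem_baseSet_trivializationAt' x
  let b := finBasis ℝ E
  have hs (i) := exists_smoothVField_eventuallyEq t.open_baseSet hxt
    (t.contMDiffOn_localFrame_baseSet (I := 𝓘(ℝ, E)) ∞ b i)
  choose s hs hs' using hs
  have hc (k i) := exists_smooth_coeff b hs' (hsm (hs k) (hs i))
  choose c hc hc' using hc
  have hbase : ∀ᶠ y in nhds x, y ∈ t.baseSet := t.open_baseSet.mem_nhds hxt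
  -- The unknowns are `g(Z, s i)` for a local frame `s`. As `Z` and `g` are parallel, the derivative
  -- along `s k` is `g(Z, D_{s k} s i)`, a combination of the same unknowns with coefficients `c k i
  -- j`.
  have h := eventually_eq_zero_of_linear_system b (x := x) (f := fun i y ↦ g.inner y (Z y) (s i y))
    (fun i ↦ g.smooth_inner hZ (hs i)) hc
    (by
      filter_upwards [hbase, Filter.eventually_all.2 hs', Filter.eventually_all.2 fun k ↦
        Filter.eventually_all.2 (hc' k)] with y hy h1 h2 k i
      have h3 : t.symmL ℝ y (b k) = s k y := by
        rw [h1 k, t.localFrame_apply_of_mem_baseSet _ hy]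
        simp [Trivialization.basisAt, hy]
      have h4 := congrFun (hg.dirDeriv_inner (s k) hZ (hs i)) y
      rw [h3]
      refine h4.trans ?_
      have h5 : D.along (s k) Z y = 0 := hDZ y _
      rw [Pi.add_apply, h5, h2 k i]
      simp)
    (fun i ↦ by simp [hx])
  filter_upwards [h, hbase, Filter.eventually_all.2 hs'] with y hy hyt h1
  refine g.nondegenerate y _ fun w ↦ ?_
  have h2 := (t.basisAt b hyt).sum_repr w
  rw [← h2, map_sum]
  refine Finset.sum_eq_zero fun i _ ↦ ?_
  rw [map_smul, ← t.localFrame_apply_of_mem_baseSet _ hyt, ← h1 i, hy i, smul_zero]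

/-- A parallel vector field which vanishes at a point of a connected manifold vanishes. -/
theorem eq_zero_of_parallel [ConnectedSpace M] {g : PseudoRiemannianMetric E M}
    {D : LinearConnection E M}
    (hsm : ∀ {X Y : VField E M}, SmoothVField X → SmoothVField Y → SmoothVField (D.along X Y))
    (hg : ParallelMetric D g) {Z : VField E M} (hZ : SmoothVField Z)
    (hDZ : ∀ (x : M) (v : TangentSpace 𝓘(ℝ, E) x), D Z x v = 0) {x : M} (hx : Z x = 0) :
    Z = 0 := by
  have hopen : IsOpen {y | Z y = 0} := isOpen_iff_mem_nhds.2 fun y hy ↦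
    eventually_eq_zero_of_parallel hsm hg hZ hDZ hy
  have hclosed : IsClosed {y | Z y = 0} := by
    have h1 : {y | Z y = 0} = ⋂ (W : VField E M) (_ : SmoothVField W),
        {y | g.inner y (Z y) (W y) = 0} := by
      ext y
      simp only [Set.mem_ofPred_eq, Set.mem_iInter]
      refine ⟨fun hy W _ ↦ by simp [hy], fun hy ↦ g.nondegenerate y _ fun w ↦ ?_⟩
      obtain ⟨W, hW, rfl⟩ := exists_smoothVField w
      exact hy W hW
    rw [h1]
    exact isClosed_iInter fun W ↦ isClosed_iInter fun hW ↦
      isClosed_eq (g.smooth_inner hZ hW).continuous continuous_const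
  ext1 y
  have := IsClopen.eq_univ ⟨hclosed, hopen⟩ ⟨x, hx⟩
  exact (Set.eq_univ_iff_forall.1 this y :)

end Propagation

end

/-! ### From the pointwise conclusions to the connected manifold -/

theorem proposition3p3 {E : Type*} [NormedAddCommGroup E] [NormedSpace ℝ E] [FiniteDimensional ℝ E]
    {M : Type*} [TopologicalSpace M] [ChartedSpace E M] [IsManifold 𝓘(ℝ, E) ∞ M]
    [T2Space M] [SecondCountableTopology M] [ConnectedSpace M]
    (hdim : 4 ≤ finrank ℝ E) (ε : ℝ) (hε : ε = -1 ∨ ε = 1)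
    (g : PseudoRiemannianMetric E M) (D : LinearConnection E M) (hD : IsLeviCivita g D)
    (J : EndField E M) (hJ : IsEpsKahler ε g D J)
    (S : TensorField12 E M) (hS : IsHomogeneousStructure g D J S)
    (ξ ζ : VField E M) (hlin : IsLinearType ε g J S ξ ζ) (hdeg : IsDegenerate g ξ) :
    (∀ (x : M) (v w : TangentSpace 𝓘(ℝ, E) x), ricci D x v w = 0) ∧
    ∃ c : ℝ, (∀ x : M, ζ x = c • ξ x) ∧
      ((ε = -1 ∨ ∃ x : M, J x (ξ x) ≠ ξ x ∧ J x (ξ x) ≠ -ξ x) → c = 0 ∨ c = -ε / 2) := by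
  have hsm {X Y : VField E M} (hX : SmoothVField X) (hY : SmoothVField Y) :
      SmoothVField ((subTensor D S).along X Y) := hX.subTensor_along hD.smooth hS.smooth hY
  have hpar := hlin.parallel hdim hε hJ hS
  have hξ (x : M) : ξ x ≠ 0 := fun hx ↦ hdeg.ne_zero
    (eq_zero_of_parallel hsm hS.metric hlin.smooth_xi (fun x v ↦ (hpar x v).1) hx)
  have hpt (x : M) := (hlin.linearTypeCurvature hdim hε hD hJ hS x (hξ x)
    (hdeg.null x)).trace_eq_zero_and_exists_smul hdim
  have hprop (x : M) (c : ℝ) (hc : ζ x = c • ξ x) (y : M) : ζ y = c • ξ y := by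
    have h0 := eq_zero_of_parallel (Z := ζ - c • ξ) (x := x) hsm hS.metric
      (hlin.smooth_zeta.sub (hlin.smooth_xi.const_smul c))
      (fun x v ↦ by
        obtain ⟨X, hX, rfl⟩ := exists_smoothVField v
        have h1 := congrFun ((subTensor D S).along_sub_right X hlin.smooth_zeta
          (hlin.smooth_xi.const_smul c)) x
        rw [LinearConnection.along_const_smul_right X c hlin.smooth_xi] at h1
        refine h1.trans ?_
        have h2 := hpar x (X x)
        have h3 : (subTensor D S).along X ζ x = 0 := h2.2
        have h4 : (subTensor D S).along X ξ x = 0 := h2.1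
        rw [Pi.sub_apply, Pi.smul_apply, h3, h4, smul_zero, sub_zero])
      (by simp [hc])
    exact sub_eq_zero.1 (congrFun h0 y)
  refine ⟨fun x v w ↦ (ricci_eq_trace hD.smooth x v w).trans ((hpt x).1 v w), ?_⟩
  -- The constant is determined at a single point, so that point is chosen to be one where the
  -- independence condition holds, if any exists.
  by_cases hind : ε = -1 ∨ ∃ x : M, J x (ξ x) ≠ ξ x ∧ J x (ξ x) ≠ -ξ x
  · obtain ⟨x, hx⟩ : ∃ x : M, ε = -1 ∨ J x (ξ x) ≠ ξ x ∧ J x (ξ x) ≠ -ξ x := by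
      rcases hind with h | ⟨x, hx⟩
      · exact ⟨Classical.arbitrary M, Or.inl h⟩
      · exact ⟨x, Or.inr hx⟩
    obtain ⟨-, c, hc, hc'⟩ := hpt x
    exact ⟨c, hprop x c hc, fun _ ↦ hc' hx⟩
  · obtain ⟨-, c, hc, -⟩ := hpt (Classical.arbitrary M)
    exact ⟨c, hprop _ c hc, fun h ↦ absurd h hind⟩
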